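/- Notation. For $m\ge 1$ let $V_m=\{0,1\}^m$ with coordinates indexed by $[m]=\{0,\dots,m-1\}$, let $\oplus$ be coordinatewise addition modulo $2$, $e_i$ the $i$-th unit vector, $\chi(\alpha)=\prod_{i\in[m]}(-1)^{\alpha(i)}$, and let $Q_m$ be the hypercube graph on $V_m$, in which $\alpha,\beta$ are adjacent iff $\alpha\oplus\beta=e_i$ for some $i\in[m]$. A pair is a two-element multiset $\{\alpha,\beta\}$ of vertices; it is odd if $\chi(\alpha)\neq\chi(\beta)$, an edge-pair if it is an edge of $Q_m$, and degenerated if $\alpha=\beta$. A pair-set in $Q_m$ is a set $A$ of pairwise disjoint pairs which, if nonempty, contains a non-degenerated pair; it is odd if all its pairs are odd. Write $\bigcup A$ for the set of vertices occurring in pairs of $A$. An odd pair-set $A$ in $Q_m$ is diminishable if either * $|A|\le m-1$ and, in case $m=4$, either $A$ contains an edge-pair or no set $X$ with $\bigcup A\subseteq X\subseteq V_4$ induces in $Q_4$ a subgraph isomorphic to $Q_3$; or * $|A|=m$, $m\ne4$, $A$ contains at least two edge-pairs, and no vertex outside $\bigcup A$ has all its neighbours in $\bigcup A$. For $i\in[m]$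 put $\sigma_i(A)=(n_0,n_1)$, where $n_k$ is the number of pairs $\{\alpha,\beta\}\in A$ with $\alpha(i)=\beta(i)=k$, and let $\rho_{i=k}(A)$ be the set of pairs in $V_{m-1}$ obtained from these pairs by deleting the $i$-th coordinate of their vertices. The coordinate $i$ is separating for $A$ if there are edge-pairs $\{\alpha,\beta\},\{\alpha',\beta'\}\in A$ with $\alpha(i)=\beta(i)\ne\alpha'(i)=\beta'(i)$. It is bad for $A$ if $|A|=m$, $i$ is separating for $A$, and there are $k\in\{0,1\}$ with $n_k=m-3$, $n_{1-k}=1$ and three distinct pairs $\{\alpha_l,\beta_l\}\in A$, $l=0,1,2$, such that $\alpha_0(i)=\alpha_1(i)=k\ne\beta_0(i)=\beta_1(i)=\alpha_2(i)=\beta_2(i)$, $\chi(\alpha_0)\ne\chi(\alpha_1)$, and for each $j\in\{0,1\}$ every neighbour $\kappa$ of $\alpha_j$ with $\kappa(i)=k$ satisfies $\kappa\in\bigcup(A\setminus\{\{\alpha_l,\beta_l\}\mid l=0,1,2\})$ or $\kappa=\alpha_{1-j}$ or $\kappa\oplus e_i\in\{\alpha_2,\beta_0,\beta_1,\beta_2\}$.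 A simple $i$-completion of an odd pair-set $A$ is any set $B$ obtained as follows. Start with $B=\emptyset$ and treat the pairs of $A$ one by one, in any order. A pair $\{\alpha,\beta\}$ with $\alpha(i)=\beta(i)$ is added to $B$. For a pair with $\alpha(i)\ne\beta(i)$, choose $\gamma\in V_m$ with $\gamma(i)=\alpha(i)$, $\chi(\gamma)\ne\chi(\alpha)$ and $\gamma,\ \gamma\oplus e_i\notin\bigcup A\cup\bigcup B$ for the current $B$, and add $\{\alpha,\gamma\}$ and $\{\gamma\oplus e_i,\beta\}$ to $B$. (For general balanced pair-sets the construction has further steps that treat even pairs; an odd pair-set has no even pairs.) Statement. Let $n\ge6$ and let $A$ be a diminishable pair-set in $Q_n$. Then there exists $i\in[n]$ such that, with $\sigma_i(A)=(n_0,n_1)$, at least one of the following conditions holds: 1. $|A|=n-1$, $\min\{n_0,n_1\}=0$ and $\max\{n_0,n_1\}\ge|A|-2$; 2. $|A|=n$, $i$ is separating for $A$, $\min\{n_0,n_1\}=1$ and $\max\{n_0,n_1\}\ge n-3$; 3. $|A|=n$ and $i$ is bad for $A$; 4. there exists a simple $i$-completion $B$ of $A$ such that $\rho_{i=0}(B)$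 and $\rho_{i=1}(B)$ are diminishable pair-sets in $Q_{n-1}$. -/

import Mathlib

namespace HypercubePairs

/-- The vertices of the `n`-dimensional hypercube: all `(0,1)`-vectors of length `n`.
The operation `⊕` (coordinatewise sum modulo 2) is the addition of this type. -/
abbrev V (n : ℕ) : Type := Fin n → ZMod 2

/-- The `i`-th unit vector `e_i`. -/
def e {n : ℕ} (i : Fin n) : V n := Pi.single i 1

/-- The hypercube `Q_n`: `{α, β}` is an edge iff `α ⊕ β = e_i` for some `i`. -/
def Q (n : ℕ) : SimpleGraph (V n) where
  Adj α β := ∃ i, α + β = e i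
  symm := ⟨fun α β h => by simpa only [add_comm] using h⟩
  loopless := ⟨fun α h => by
    obtain ⟨i, hi⟩ := h
    have h1 := congrFun hi i
    rw [Pi.add_apply, CharTwo.add_self_eq_zero] at h1
    simp [e] at h1⟩

/-- The parity `χ(α) = ∏ (-1) ^ α(i)` of a vertex. -/
def chi {n : ℕ} (α : V n) : ℤ := ∏ i, (-1 : ℤ) ^ (α i).val

/-- For `α : V n` and a coordinate `i`, the vector of length `n - 1` obtained by deleting the
`i`-th coordinate. -/
def del {n : ℕ} (i : Fin n) (α : V n) : V (n - 1) := fun j =>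
  if (j : ℕ) < (i : ℕ) then α ⟨j, by omega⟩ else α ⟨j + 1, by omega⟩

/-- A pair: a two-element multiset of vertices. -/
abbrev Pair (n : ℕ) : Type := Sym2 (V n)

/-- `χ(α, β) = χ(α) + χ(β)`. -/
def pairChi {n : ℕ} (p : Pair n) : ℤ :=
  Sym2.lift ⟨fun α β => chi α + chi β, fun _ _ => add_comm _ _⟩ p

/-- `{α, β}` is even if `χ(α) = χ(β)`. -/
def IsEvenPair {n : ℕ} (p : Pair n) : Prop := (p.map chi).IsDiag

/-- `{α, β}` is odd if `χ(α) ≠ χ(β)`. -/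
def IsOddPair {n : ℕ} (p : Pair n) : Prop := ¬ (p.map chi).IsDiag

/-- `{α, β}` is an edge-pair if it is an edge of the hypercube. -/
def IsEdgePair {n : ℕ} (p : Pair n) : Prop := p ∈ (Q n).edgeSet

/-- A set of pairs is a pair-set if its pairs are pairwise disjoint and, when it is nonempty,
at least one of its pairs is not degenerated. -/
def IsPairSet {n : ℕ} (A : Finset (Pair n)) : Prop :=
  (∀ p ∈ A, ∀ q ∈ A, p ≠ q → ∀ v, v ∈ p → v ∉ q) ∧
    (A.Nonempty → ∃ p ∈ A, ¬ p.IsDiag)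

/-- The set `⋃ A` of all vertices occurring in pairs of `A`. -/
def verts {n : ℕ} (A : Finset (Pair n)) : Set (V n) := {v | ∃ p ∈ A, v ∈ p}

/-- `χ(A)`. -/
def setChi {n : ℕ} (A : Finset (Pair n)) : ℤ := ∑ p ∈ A, pairChi p

/-- Balanced pair-sets. -/
def IsBalanced {n : ℕ} (A : Finset (Pair n)) : Prop := IsPairSet A ∧ setChi A = 0

/-- Odd pair-sets. -/
def IsOdd {n : ℕ} (A : Finset (Pair n)) : Prop := IsPairSet A ∧ ∀ p ∈ A, IsOddPair p

/-- The vertices encompassed by `X`: all their neighbours belong to `X`. -/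
def encompassed {n : ℕ} (X : Set (V n)) : Set (V n) := {α | ∀ β, (Q n).Adj α β → β ∈ X}

/-- The vertices outside `X` that are encompassed by `X`. -/
def enc {n : ℕ} (X : Set (V n)) : Set (V n) := encompassed X \ X

open Classical in
/-- The pairs `{α, β}` of `A` with `α(i) = β(i) = k`. -/
noncomputable def side {n : ℕ} (i : Fin n) (k : ZMod 2) (A : Finset (Pair n)) :
    Finset (Pair n) :=
  A.filter fun p => ∀ v ∈ p, v i = k

/-- The component `n_k` of `σ_i(A) = (n_0, n_1)`: the number of pairs `{α, β}` of `A` with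
`α(i) = β(i) = k`. -/
noncomputable def sigma {n : ℕ} (i : Fin n) (k : ZMod 2) (A : Finset (Pair n)) : ℕ :=
  (side i k A).card

/-- The restriction `ρ_{i=k}(A)`: keep the pairs `{α, β}` with `α(i) = β(i) = k` and delete
their `i`-th coordinate. -/
noncomputable def rho {n : ℕ} (i : Fin n) (k : ZMod 2) (A : Finset (Pair n)) :
    Finset (Pair (n - 1)) :=
  (side i k A).image (Sym2.map (del i))

/-- Diminishable pair-sets in `Q_n`. -/
def IsDiminishable {n : ℕ} (A : Finset (Pair n)) : Prop :=
  IsOdd A ∧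
    ((A.card < n ∧
        (n = 4 →
          (∃ p ∈ A, IsEdgePair p) ∨
            ¬ ∃ X : Set (V n), verts A ⊆ X ∧ Nonempty ((Q n).induce X ≃g Q 3))) ∨
      (A.card = n ∧ n ≠ 4 ∧
        (∃ p ∈ A, ∃ q ∈ A, p ≠ q ∧ IsEdgePair p ∧ IsEdgePair q) ∧
        enc (verts A) = ∅))

/-- The coordinate `i` is separating for `A` if two edge-pairs of `A` are separated by `i`. -/
def IsSeparating {n : ℕ} (i : Fin n) (A : Finset (Pair n)) : Prop :=
  ∃ α β α' β' : V n, s(α, β) ∈ A ∧ s(α', β') ∈ A ∧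
    IsEdgePair s(α, β) ∧ IsEdgePair s(α', β') ∧
    α i = β i ∧ β i ≠ α' i ∧ α' i = β' i

/-- The coordinate `i` is bad for `A`. -/
def IsBad {n : ℕ} (i : Fin n) (A : Finset (Pair n)) : Prop :=
  A.card = n ∧ IsSeparating i A ∧
    ∃ k : ZMod 2, sigma i k A + 3 = n ∧ sigma i (1 - k) A = 1 ∧
      ∃ α₀ β₀ α₁ β₁ α₂ β₂ : V n,
        s(α₀, β₀) ∈ A ∧ s(α₁, β₁) ∈ A ∧ s(α₂, β₂) ∈ A ∧
        s(α₀, β₀) ≠ s(α₁, β₁) ∧ s(α₀, β₀) ≠ s(α₂, β₂) ∧ s(α₁, β₁) ≠ s(α₂, β₂) ∧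
        α₀ i = k ∧ α₁ i = k ∧
        β₀ i ≠ k ∧ β₁ i ≠ k ∧ α₂ i ≠ k ∧ β₂ i ≠ k ∧
        chi α₀ ≠ chi α₁ ∧
        ∀ κ : V n, κ i = k →
          ((Q n).Adj κ α₀ →
            κ ∈ verts (A \ {s(α₀, β₀), s(α₁, β₁), s(α₂, β₂)}) ∨ κ = α₁ ∨
              κ + e i ∈ ({α₂, β₀, β₁, β₂} : Set (V n))) ∧
          ((Q n).Adj κ α₁ →
            κ ∈ verts (A \ {s(α₀, β₀), s(α₁, β₁), s(α₂, β₂)}) ∨ κ = α₀ ∨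
              κ + e i ∈ ({α₂, β₀, β₁, β₂} : Set (V n)))

/-- `R` is an `(A, i)`-matching: a perfect matching on the even pairs of `A` such that matched
pairs have opposite values of `χ`, and matched degenerated pairs agree in the coordinate `i`. -/
def IsMatchingFor {n : ℕ} (i : Fin n) (A : Finset (Pair n)) (R : Set (Sym2 (Pair n))) : Prop :=
  (∀ m ∈ R, ¬ m.IsDiag) ∧
  (∀ m ∈ R, ∀ p ∈ m, p ∈ A ∧ IsEvenPair p) ∧
  (∀ p ∈ A, IsEvenPair p → ∃! m, m ∈ R ∧ p ∈ m) ∧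
  (∀ p q : Pair n, s(p, q) ∈ R → pairChi p + pairChi q = 0) ∧
  (∀ α β : V n, s(s(α, α), s(β, β)) ∈ R → α i = β i)

/-- `γ, γ ⊕ e_i ∉ ⋃ A ∪ ⋃ B`. -/
def IsFree {n : ℕ} (i : Fin n) (A B : Finset (Pair n)) (γ : V n) : Prop :=
  γ ∉ verts A ∪ verts B ∧ γ + e i ∉ verts A ∪ verts B

/-- One step of the non-deterministic construction of simple `i`-completions of `A` for an
`(A, i)`-matching `R`. A state `(B, A')` consists of the pairs `B` created so far and of the
pairs `A'` of `A` that still have to be treated. -/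
inductive Step {n : ℕ} (i : Fin n) (A : Finset (Pair n)) (R : Set (Sym2 (Pair n))) :
    Finset (Pair n) × Finset (Pair n) → Finset (Pair n) × Finset (Pair n) → Prop
  | oddSame (B A' : Finset (Pair n)) (α β : V n)
      (hmem : s(α, β) ∈ A') (hodd : IsOddPair s(α, β)) (hi : α i = β i) :
      Step i A R (B, A') (B ∪ {s(α, β)}, A' \ {s(α, β)})
  | oddCross (B A' : Finset (Pair n)) (α β γ : V n)
      (hmem : s(α, β) ∈ A') (hodd : IsOddPair s(α, β)) (hi : α i ≠ β i)
      (hγi : γ i = α i) (hγ : chi α ≠ chi γ) (hfree : IsFree i A B γ) :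
      Step i A R (B, A') (B ∪ {s(α, γ), s(γ + e i, β)}, A' \ {s(α, β)})
  | evenSame (B A' : Finset (Pair n)) (α β α' β' : V n)
      (hmem : s(α, β) ∈ A') (hmem' : s(α', β') ∈ A')
      (heven : IsEvenPair s(α, β)) (heven' : IsEvenPair s(α', β'))
      (hR : s(s(α, β), s(α', β')) ∈ R)
      (hi : α i = β i) (hi' : β i = α' i) (hi'' : α' i = β' i) :
      Step i A R (B, A') (B ∪ {s(α, β), s(α', β')}, A' \ {s(α, β), s(α', β')})
  | evenThree (B A' : Finset (Pair n)) (α β α' β' γ : V n)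
      (hmem : s(α, β) ∈ A') (hmem' : s(α', β') ∈ A')
      (heven : IsEvenPair s(α, β)) (heven' : IsEvenPair s(α', β'))
      (hR : s(s(α, β), s(α', β')) ∈ R)
      (hi : α i = β i) (hi' : β i = α' i) (hi'' : α' i ≠ β' i)
      (hγi : γ i ≠ β' i) (hγ : chi γ = chi α') (hfree : IsFree i A B γ) :
      Step i A R (B, A')
        (B ∪ {s(α, β), s(α', γ), s(γ + e i, β')}, A' \ {s(α, β), s(α', β')})
  | evenOpposite (B A' : Finset (Pair n)) (α β α' β' γ γ' : V n)
      (hmem : s(α, β) ∈ A') (hmem' : s(α', β') ∈ A')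
      (heven : IsEvenPair s(α, β)) (heven' : IsEvenPair s(α', β'))
      (hR : s(s(α, β), s(α', β')) ∈ R)
      (hi : α i = β i) (hi' : β i ≠ α' i) (hi'' : α' i = β' i)
      (hdeg : α' ≠ β') (hne : γ ≠ γ')
      (hγi : γ i = α' i) (hγi' : γ' i = α' i)
      (hγ : chi γ = chi γ') (hγ' : chi γ' ≠ chi α')
      (hfree : IsFree i A B γ) (hfree' : IsFree i A B γ') :
      Step i A R (B, A')
        (B ∪ {s(α, β), s(α', γ), s(β', γ'), s(γ + e i, γ' + e i)},
          A' \ {s(α, β), s(α', β')})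
  | evenCross (B A' : Finset (Pair n)) (α β α' β' γ γ' : V n)
      (hmem : s(α, β) ∈ A') (hmem' : s(α', β') ∈ A')
      (heven : IsEvenPair s(α, β)) (heven' : IsEvenPair s(α', β'))
      (hR : s(s(α, β), s(α', β')) ∈ R)
      (hi : α i ≠ β i) (hi' : α' i ≠ β' i) (hi'' : α i = α' i)
      (hne : γ ≠ γ') (hγi : γ i = α i) (hγi' : γ' i = α i)
      (hγ : chi γ = chi α) (hγ' : chi γ' = chi α')
      (hfree : IsFree i A B γ) (hfree' : IsFree i A B γ') :
      Step i A R (B, A')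
        (B ∪ {s(α, γ), s(α', γ'), s(γ + e i, β), s(γ' + e i, β')},
          A' \ {s(α, β), s(α', β')})

/-- `B` is a simple `i`-completion of the balanced pair-set `A`: for some `(A, i)`-matching, some
run of the construction starts with nothing created and all pairs of `A` untreated, and ends with
the pairs of `B` created and no pair left to treat. -/
def IsSimpleCompletion {n : ℕ} (i : Fin n) (A B : Finset (Pair n)) : Prop :=
  IsBalanced A ∧
    ∃ R : Set (Sym2 (Pair n)), IsMatchingFor i A R ∧
      Relation.ReflTransGen (Step i A R) (∅, A) (B, ∅)

end HypercubePairs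

open HypercubePairs

/-!
Write `n = m + 1` and project along a coordinate `i`. A pair of `A` inside one side of the cube is
an odd pair of `Q m` on that side, and a crossing pair leaves one vertex `col k j` on each side
`k`; the two vertices have the same parity. A simple `i`-completion amounts to choosing, for every
crossing pair `j`, a vertex `g j` of `Q m` of the opposite parity that is used on neither side
(`isSimpleCompletion_biUnion_piece`): on the side `k`, the pair `j` becomes `{col k j, g j}`. A
side of the completion then has `sigma i k A` plus the number of crossing pairs as its size. Below
`m` nothing more has to be shown. A side with exactly `m` pairs is critical: it needs two
edge-pairs and must encompass no outside vertex.

The choice uses only that a vertex has `m` neighbours, that two vertices have at most two common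
neighbours, and that a parity class has `2 ^ (m - 1)` elements.

* Edge-pairs. Two crossing pairs of the same parity have at least `2 * m - 2` candidates for an
  edge-pair on a given side, more than are used (`Frame.Reach.step`). Only when two pairs of one
  parity and one of the other cross is this count too weak, and distinct representatives are
  chosen by hand (`Frame.solvable_of_cnt_two_one`).
* Encompassed vertices. A critical side has `m` vertices of each parity, so a vertex is
  encompassed only if they form its neighbourhood; given the other `m - 1` of them, at most one
  choice of `g j` causes this (`Frame.Valid.modify`). So one crossing pair of each parity is kept
  for the end (`Frame.Valid.exists_safe`). If all crossing pairs have the same parity, the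
  vertices of that parity are beyond control; the vertex they encompass is then itself chosen as
  some `g j`, which also makes an edge-pair (`Frame.Forced`). It is available because it is not
  used on the other side: otherwise `A` would encompass it (`notMem_base_of_enc_eq_empty`).

The coordinate is found as follows. If `A` has at most `n - 2` pairs, any coordinate will do. With
`n - 1` pairs, either some coordinate has pairs on both sides and no side is critical, or, unless
the first alternative of the theorem holds, every coordinate crosses at least three pairs. If no
pair lies inside a side for any coordinate, all pairs are antipodal, hence `n` is odd, and the
parity of `m` gives the room for two new edge-pairs on both sides. With `n` pairs, the coordinate
separates two edge-pairs, so that both sides inherit one of them; if a side is critical, then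
either the second alternative holds or at least three pairs cross. Bad coordinates satisfy the
second alternative.
-/

namespace HypercubePairs

open Finset

/-! ### Parities and neighbourhoods in the hypercube -/

/-- The parity of a vertex, as an element of `ZMod 2`; it is the additive form of `chi`. -/
def par {m : ℕ} (v : V m) : ZMod 2 := ∑ i, v i

theorem chi_eq_par {m : ℕ} (v : V m) : chi v = (-1) ^ (par v).val := by
  have hadd : ∀ x y : ZMod 2, (-1 : ℤ) ^ (x + y).val = (-1) ^ x.val * (-1) ^ y.val := by decide
  have : ∀ s : Finset (Fin m), ∏ i ∈ s, (-1 : ℤ) ^ (v i).val = (-1) ^ (∑ i ∈ s, v i).val := by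
    intro s
    induction s using Finset.induction_on with
    | empty => simp
    | insert a s ha ih => rw [prod_insert ha, sum_insert ha, hadd, ih]
  exact this univ

theorem chi_eq_chi_iff {m : ℕ} (v w : V m) : chi v = chi w ↔ par v = par w := by
  have h : ∀ x y : ZMod 2, (-1 : ℤ) ^ x.val = (-1) ^ y.val ↔ x = y := by decide
  rw [chi_eq_par, chi_eq_par, h]

theorem zmod_two_ne_iff {x y : ZMod 2} : x ≠ y ↔ x = y + 1 := by
  revert x y; decide

theorem zmod_two_eq_or (x y : ZMod 2) : x = y ∨ x = y + 1 := by
  revert x y; decide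

theorem zmod_two_add_one_add_one (x : ZMod 2) : x + 1 + 1 = x := by
  revert x; decide

theorem zmod_two_add_one_ne (x : ZMod 2) : x + 1 ≠ x := by
  revert x; decide

theorem V_add_self {m : ℕ} (v : V m) : v + v = 0 :=
  funext fun i => CharTwo.add_self_eq_zero (v i)

theorem par_e {m : ℕ} (i : Fin m) : par (e i) = 1 := by
  simp [par, e]

theorem par_add {m : ℕ} (v w : V m) : par (v + w) = par v + par w := by
  simp [par, sum_add_distrib]

theorem e_self {m : ℕ} (i : Fin m) : (e i : V m) i = 1 := by simp [e]

theorem e_of_ne {m : ℕ} {i j : Fin m} (h : j ≠ i) : (e i : V m) j = 0 := by simp [e, h]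

theorem e_injective {m : ℕ} : Function.Injective (e : Fin m → V m) := by
  intro i j h
  by_contra hne
  have := congrFun h i
  rw [e_self, e_of_ne hne] at this
  exact one_ne_zero this

/-- The neighbours of a vertex in the hypercube. -/
def nbr {m : ℕ} (v : V m) : Finset (V m) := univ.image fun i => v + e i

theorem mem_nbr {m : ℕ} {v w : V m} : w ∈ nbr v ↔ ∃ i, w = v + e i := by
  simp [nbr, eq_comm]

theorem adj_iff_mem_nbr {m : ℕ} {v w : V m} : (Q m).Adj v w ↔ w ∈ nbr v := by
  rw [mem_nbr]
  constructor
  · rintro ⟨i, hi⟩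
    exact ⟨i, by rw [← hi, ← add_assoc, V_add_self, zero_add]⟩
  · rintro ⟨i, rfl⟩
    exact ⟨i, by rw [← add_assoc, V_add_self, zero_add]⟩

theorem mem_nbr_comm {m : ℕ} {v w : V m} : w ∈ nbr v ↔ v ∈ nbr w := by
  rw [← adj_iff_mem_nbr, ← adj_iff_mem_nbr, SimpleGraph.adj_comm]

theorem par_of_mem_nbr {m : ℕ} {v w : V m} (h : w ∈ nbr v) : par w = par v + 1 := by
  obtain ⟨i, rfl⟩ := mem_nbr.1 h
  rw [par_add, par_e]

theorem card_nbr {m : ℕ} (v : V m) : #(nbr v) = m := by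
  rw [nbr, card_image_of_injective _ fun i j h => e_injective (add_left_cancel h)]
  simp

/-- Two distinct vertices of a hypercube have at most two common neighbours. -/
theorem card_nbr_inter_le {m : ℕ} {v v' : V m} (h : v ≠ v') : #(nbr v ∩ nbr v') ≤ 2 := by
  rcases (nbr v ∩ nbr v').eq_empty_or_nonempty with h0 | ⟨w, hw⟩
  · simp [h0]
  obtain ⟨hw1, hw2⟩ := mem_inter.1 hw
  obtain ⟨i₀, hi₀⟩ := mem_nbr.1 hw1
  obtain ⟨j₀, hj₀⟩ := mem_nbr.1 hw2
  have hsub : nbr v ∩ nbr v' ⊆ {v + e i₀, v + e j₀} := by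
    intro x hx
    obtain ⟨hx1, hx2⟩ := mem_inter.1 hx
    obtain ⟨i, hi⟩ := mem_nbr.1 hx1
    obtain ⟨j, hj⟩ := mem_nbr.1 hx2
    have hij : i ≠ j := by
      rintro rfl
      exact h (add_right_cancel (hi.symm.trans hj))
    have hi0 : i = i₀ ∨ i = j₀ := by
      by_contra hcon
      push Not at hcon
      have h1 := congrFun (hi.symm.trans hj) i
      have h2 := congrFun (hi₀.symm.trans hj₀) i
      simp only [Pi.add_apply, e_self, e_of_ne hij, e_of_ne hcon.1, e_of_ne hcon.2] at h1 h2
      rw [add_zero, add_zero] at h2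
      rw [h2, add_zero] at h1
      exact zmod_two_add_one_ne _ h1
    rcases hi0 with rfl | rfl <;> simp [hi]
  exact (card_le_card hsub).trans card_le_two

theorem eq_of_nbr_subset {m : ℕ} (hm : 3 ≤ m) {v v' : V m} (h : nbr v ⊆ nbr v') : v = v' := by
  by_contra hne
  have h1 := card_nbr_inter_le hne
  rw [inter_eq_left.2 h, card_nbr] at h1
  omega

theorem two_mul_sub_two_le_card_nbr_union {m : ℕ} {v v' : V m} (h : v ≠ v') :
    2 * m - 2 ≤ #(nbr v ∪ nbr v') := by
  have h1 := card_nbr_inter_le h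
  have h2 := card_union_add_card_inter (nbr v) (nbr v')
  rw [card_nbr, card_nbr] at h2
  omega

/-- The vertices of `S` of parity `q`. -/
def cl {m : ℕ} (q : ZMod 2) (S : Finset (V m)) : Finset (V m) := S.filter fun v => par v = q

theorem mem_cl {m : ℕ} {q : ZMod 2} {S : Finset (V m)} {v : V m} :
    v ∈ cl q S ↔ v ∈ S ∧ par v = q := by simp [cl]

theorem cl_union {m : ℕ} (q : ZMod 2) (S T : Finset (V m)) : cl q (S ∪ T) = cl q S ∪ cl q T :=
  filter_union _ _ _

theorem nbr_subset_cl {m : ℕ} {v : V m} {S : Finset (V m)} (h : nbr v ⊆ S) :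
    nbr v ⊆ cl (par v + 1) S := fun _ hw => mem_cl.2 ⟨h hw, par_of_mem_nbr hw⟩

theorem card_cl_univ {m : ℕ} (hm : 0 < m) (q : ZMod 2) :
    2 * #(cl q (univ : Finset (V m))) = 2 ^ m := by
  have hcard : ∀ q : ZMod 2,
      #(cl q (univ : Finset (V m))) ≤ #(cl (q + 1) (univ : Finset (V m))) := by
    intro q
    refine card_le_card_of_injOn (fun v => v + e ⟨0, hm⟩) ?_ fun v _ w _ h => add_right_cancel h
    intro v hv
    have := (mem_cl.1 (mem_coe.1 hv)).2
    simp [mem_cl, par_add, par_e, this]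
  have h1 := hcard q
  have h2 := hcard (q + 1)
  rw [zmod_two_add_one_add_one] at h2
  have h3 : #(cl q (univ : Finset (V m))) + #(cl (q + 1) (univ : Finset (V m))) = 2 ^ m := by
    rw [← card_union_of_disjoint]
    · have : cl q (univ : Finset (V m)) ∪ cl (q + 1) univ = univ := by
        ext v
        simp [mem_cl, zmod_two_eq_or]
      rw [this]
      simp [ZMod.card]
    · rw [disjoint_left]
      intro v hv hv'
      exact zmod_two_add_one_ne q ((mem_cl.1 hv').2.symm.trans (mem_cl.1 hv).2)
  omega

theorem lt_card_cl_univ {m : ℕ} (hm : 5 ≤ m) (q : ZMod 2) :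
    2 * m + 4 < #(cl q (univ : Finset (V m))) := by
  have h := card_cl_univ (m := m) (by omega) q
  have : ∀ k, 2 * (2 * (k + 5) + 4) < 2 ^ (k + 5) := by
    intro k
    induction k with
    | zero => norm_num
    | succ k ih => rw [show k + 1 + 5 = (k + 5) + 1 by ring, pow_succ]; omega
  have h2 := this (m - 5)
  rw [Nat.sub_add_cancel hm] at h2
  omega

/-- A set of fewer than `m` vertices can be completed to a full neighbourhood by at most one
further vertex: two such neighbourhoods would share too many vertices. -/
theorem eq_of_nbr_subset_insert {m : ℕ} (hm : 5 ≤ m) {T : Finset (V m)} (hT : #T < m)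
    {x x' v v' : V m} (h : nbr v ⊆ insert x T) (h' : nbr v' ⊆ insert x' T) : x = x' := by
  have hc : ∀ {x v : V m}, nbr v ⊆ insert x T → m - 1 ≤ #(nbr v ∩ T) := by
    intro x v h
    have h1 : nbr v ⊆ insert x (nbr v ∩ T) := by
      intro w hw
      rcases mem_insert.1 (h hw) with rfl | h2
      · exact mem_insert_self _ _
      · exact mem_insert_of_mem (mem_inter.2 ⟨hw, h2⟩)
    have h2 := (card_le_card h1).trans (card_insert_le _ _)
    rw [card_nbr] at h2
    omega
  have heq : v = v' := by
    by_contra hne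
    have h1 := card_nbr_inter_le hne
    have h2 := card_union_add_card_inter (nbr v ∩ T) (nbr v' ∩ T)
    have h3 : #(nbr v ∩ T ∪ nbr v' ∩ T) ≤ #T :=
      card_le_card (union_subset inter_subset_right inter_subset_right)
    have h4 : #(nbr v ∩ T ∩ (nbr v' ∩ T)) ≤ #(nbr v ∩ nbr v') :=
      card_le_card (inter_subset_inter inter_subset_left inter_subset_left)
    have := hc h
    have := hc h'
    omega
  subst heq
  by_contra hne
  have h1 : nbr v ⊆ T := by
    intro w hw
    rcases mem_insert.1 (h hw) with rfl | h2
    · exact (mem_insert.1 (h' hw)).resolve_left hne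
    · exact h2
  have := card_le_card h1
  rw [card_nbr] at this
  omega

/-! ### Choosing the new vertices of a completion -/

/-- The combinatorial data left after projecting an odd pair-set of `Q (m + 1)` along a coordinate.
The pairs contained in the side `k` contribute their vertices `X k`, at most `s k` of each
parity. A crossing pair `j` contributes one vertex `col k j` on each side; both have the parity
`cls j`. The two cardinality bounds are what a diminishable pair-set provides in the cases where
every completion has sides of at most `m` pairs. -/
structure Frame (m : ℕ) (ι : Type*) [Fintype ι] where
  X : ZMod 2 → Finset (V m)
  col : ZMod 2 → ι → V m
  cls : ι → ZMod 2
  s : ZMod 2 → ℕ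
  col_injective : ∀ k, Function.Injective (col k)
  par_col : ∀ k j, par (col k j) = cls j
  card_X : ∀ k q, #(cl q (X k)) ≤ s k
  card_le : ∀ k, s k + Fintype.card ι ≤ m
  card_add_le : ∀ k, s k + s (k + 1) + Fintype.card ι ≤ m + 1

namespace Frame

variable {m : ℕ} {ι : Type*} [Fintype ι] (F : Frame m ι)

/-- The vertices of the side `k` that are used by the original pairs. -/
def base (k : ZMod 2) : Finset (V m) := F.X k ∪ univ.image (F.col k)

/-- The members of `D` of class `q`. -/
def inCls (q : ZMod 2) (D : Finset ι) : Finset ι := D.filter fun j => F.cls j = q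

/-- The number of crossing pairs of class `q`. -/
def cnt (q : ZMod 2) : ℕ := #(F.inCls q univ)

/-- `g` chooses admissible new vertices for the crossing pairs in `D`: of the parity opposite to
the class of the pair, unused on both sides, and pairwise distinct. -/
structure Valid (g : ι → V m) (D : Finset ι) : Prop where
  par_eq : ∀ j ∈ D, par (g j) = F.cls j + 1
  notMem : ∀ j ∈ D, ∀ k, g j ∉ F.base k
  injOn : Set.InjOn g D

variable {F}

theorem mem_inCls {q : ZMod 2} {D : Finset ι} {j : ι} : j ∈ F.inCls q D ↔ j ∈ D ∧ F.cls j = q := by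
  simp [inCls]

theorem mem_base {k : ZMod 2} {v : V m} : v ∈ F.base k ↔ v ∈ F.X k ∨ ∃ j, F.col k j = v := by
  simp [base]

theorem col_mem_base (k : ZMod 2) (j : ι) : F.col k j ∈ F.base k := mem_base.2 (Or.inr ⟨j, rfl⟩)

theorem notMem_bases_iff {k : ZMod 2} {v : V m} :
    v ∉ F.base k ∪ F.base (k + 1) ↔ ∀ l, v ∉ F.base l := by
  rw [mem_union, not_or]
  constructor
  · rintro ⟨h1, h2⟩ l
    rcases zmod_two_eq_or l k with rfl | rfl <;> assumption
  · exact fun h => ⟨h _, h _⟩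

theorem Valid.mono {g : ι → V m} {D D' : Finset ι} (h : F.Valid g D) (hD : D' ⊆ D) :
    F.Valid g D' :=
  ⟨fun j hj => h.par_eq j (hD hj), fun j hj => h.notMem j (hD hj),
    h.injOn.mono (coe_subset.2 hD)⟩

theorem Valid.empty (g : ι → V m) : F.Valid g ∅ := ⟨by simp, by simp, by simp⟩

theorem inCls_mono (q : ZMod 2) {D D' : Finset ι} (h : D ⊆ D') : F.inCls q D ⊆ F.inCls q D' :=
  filter_subset_filter _ h

/-- The vertices of parity `q` only see the choices made at pairs of class `q`. -/
theorem Valid.nbr_subset_congr {g g' : ι → V m} {D : Finset ι} (h : F.Valid g univ) {k q : ZMod 2}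
    (hgg' : ∀ j, F.cls j = q → j ∈ D ∧ g' j = g j) {v : V m} (hv : par v = q)
    (hsub : nbr v ⊆ F.base k ∪ univ.image g) : nbr v ⊆ F.base k ∪ D.image g' := by
  intro w hw
  have hpw := par_of_mem_nbr hw
  rcases mem_union.1 (hsub hw) with h1 | h1
  · exact mem_union_left _ h1
  · obtain ⟨j, -, rfl⟩ := mem_image.1 h1
    rw [h.par_eq j (mem_univ _), hv] at hpw
    obtain ⟨h2, h3⟩ := hgg' j (add_right_cancel hpw)
    exact mem_union_right _ (mem_image.2 ⟨j, h2, h3⟩)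

theorem card_inCls_add (q : ZMod 2) (D : Finset ι) :
    #(F.inCls q D) + #(F.inCls (q + 1) D) = #D := by
  classical
  rw [← card_union_of_disjoint]
  · congr 1
    ext j
    rw [mem_union, mem_inCls, mem_inCls, ← and_or_left]
    simp [zmod_two_eq_or]
  · rw [disjoint_left]
    intro j hj hj'
    exact zmod_two_add_one_ne q ((mem_inCls.1 hj').2.symm.trans (mem_inCls.1 hj).2)

theorem cnt_add (q : ZMod 2) : F.cnt q + F.cnt (q + 1) = Fintype.card ι := card_inCls_add q univ

theorem card_cl_base_le (k q : ZMod 2) : #(cl q (F.base k)) ≤ F.s k + F.cnt q := by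
  classical
  rw [base, cl_union]
  refine (card_union_le _ _).trans (add_le_add (F.card_X k q) ?_)
  have : cl q (univ.image (F.col k)) ⊆ (F.inCls q univ).image (F.col k) := by
    intro v hv
    obtain ⟨h1, h2⟩ := mem_cl.1 hv
    obtain ⟨j, -, rfl⟩ := mem_image.1 h1
    exact mem_image_of_mem _ (mem_inCls.2 ⟨mem_univ _, by rw [← h2, F.par_col]⟩)
  exact (card_le_card this).trans card_image_le

theorem card_cl_bases_le (k q : ZMod 2) :
    #(cl q (F.base k ∪ F.base (k + 1))) ≤ F.s k + F.s (k + 1) + 2 * F.cnt q := by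
  rw [cl_union]
  have h1 := card_cl_base_le (F := F) k q
  have h2 := card_cl_base_le (F := F) (k + 1) q
  have := card_union_le (cl q (F.base k)) (cl q (F.base (k + 1)))
  omega

theorem Valid.card_cl_image_le {g : ι → V m} {D : Finset ι} (h : F.Valid g D) (q : ZMod 2) :
    #(cl (q + 1) (D.image g)) ≤ #(F.inCls q D) := by
  have : cl (q + 1) (D.image g) ⊆ (F.inCls q D).image g := by
    intro v hv
    obtain ⟨h1, h2⟩ := mem_cl.1 hv
    obtain ⟨j, hj, rfl⟩ := mem_image.1 h1
    rw [h.par_eq j hj] at h2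
    exact mem_image_of_mem _ (mem_inCls.2 ⟨hj, add_right_cancel h2⟩)
  exact (card_le_card this).trans card_image_le

/-- A set of candidates that outnumbers the vertices already used contains an admissible one. -/
theorem Valid.exists_free {g : ι → V m} {D : Finset ι} (h : F.Valid g D) (q : ZMod 2)
    {S : Finset (V m)} (hS : ∀ x ∈ S, par x = q + 1) {k : ZMod 2}
    (hcard : F.s k + F.s (k + 1) + 2 * F.cnt (q + 1) + #(F.inCls q D) < #S) :
    ∃ x ∈ S, (∀ l, x ∉ F.base l) ∧ x ∉ D.image g := by
  by_contra hcon
  push Not at hcon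
  have hsub : S ⊆ cl (q + 1) (F.base k ∪ F.base (k + 1)) ∪ cl (q + 1) (D.image g) := by
    intro x hx
    by_cases hb : x ∈ F.base k ∪ F.base (k + 1)
    · exact mem_union_left _ (mem_cl.2 ⟨hb, hS x hx⟩)
    · exact mem_union_right _ (mem_cl.2 ⟨hcon x hx (notMem_bases_iff.1 hb), hS x hx⟩)
  have h1 := (card_le_card hsub).trans (card_union_le _ _)
  have h2 := card_cl_bases_le (F := F) k (q + 1)
  have h3 := h.card_cl_image_le q
  omega

theorem card_inCls_lt {q : ZMod 2} {D : Finset ι} {j : ι} (hj : j ∉ D) (hq : F.cls j = q) :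
    #(F.inCls q D) < F.cnt q :=
  card_lt_card ⟨inCls_mono q (subset_univ D), fun h =>
    hj (mem_inCls.1 (h (mem_inCls.2 ⟨mem_univ j, hq⟩))).1⟩

/-- The used vertices never exhaust a parity class: at least three admissible choices remain. -/
theorem free_bound (hm : 5 ≤ m) {D : Finset ι} {j : ι} (hj : j ∉ D) (k : ZMod 2) :
    F.s k + F.s (k + 1) + 2 * F.cnt (F.cls j + 1) + #(F.inCls (F.cls j) D) + 2 <
      #(cl (F.cls j + 1) (univ : Finset (V m))) := by
  have h1 := F.card_add_le k
  have h2 := cnt_add (F := F) (F.cls j)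
  have h3 := card_inCls_lt hj rfl (F := F)
  have h4 := lt_card_cl_univ hm (F.cls j + 1)
  omega

variable [DecidableEq ι]

theorem Valid.update {g : ι → V m} {D : Finset ι} (h : F.Valid g D) {j : ι} (hj : j ∉ D) {x : V m}
    (hx : par x = F.cls j + 1) (hb : ∀ k, x ∉ F.base k) (hg : x ∉ D.image g) :
    F.Valid (Function.update g j x) (insert j D) := by
  have hu : ∀ l ∈ D, Function.update g j x l = g l := fun l hl =>
    Function.update_of_ne (by rintro rfl; exact hj hl) _ _
  refine ⟨?_, ?_, ?_⟩
  · intro l hl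
    rcases mem_insert.1 hl with rfl | hl
    · rwa [Function.update_self]
    · rw [hu l hl]
      exact h.par_eq l hl
  · intro l hl k
    rcases mem_insert.1 hl with rfl | hl
    · rw [Function.update_self]
      exact hb k
    · rw [hu l hl]
      exact h.notMem l hl k
  · rw [coe_insert, Set.injOn_insert (by simpa using hj)]
    refine ⟨h.injOn.congr fun l hl => (hu l (mem_coe.1 hl)).symm, ?_⟩
    rw [Function.update_self]
    rintro ⟨l, hl, hlx⟩
    exact hg (mem_image.2 ⟨l, hl, by rw [← hlx, hu l (mem_coe.1 hl)]⟩)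

/-- Every admissible partial choice extends to all crossing pairs. -/
theorem Valid.extend (hm : 5 ≤ m) {g : ι → V m} {D : Finset ι} (h : F.Valid g D) :
    ∃ g', F.Valid g' univ ∧ ∀ j ∈ D, g' j = g j := by
  have key : ∀ T : Finset ι, ∃ g', F.Valid g' (T ∪ D) ∧ ∀ j ∈ D, g' j = g j := by
    intro T
    induction T using Finset.induction_on with
    | empty => exact ⟨g, by simpa using h, fun _ _ => rfl⟩
    | insert j T _ ih =>
      obtain ⟨g', hg', hD⟩ := ih
      by_cases hj : j ∈ T ∪ D
      · exact ⟨g', by rwa [insert_union, insert_eq_of_mem hj], hD⟩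
      have hb := free_bound hm hj (F := F) 0
      obtain ⟨x, hxS, hxb, hxg⟩ := hg'.exists_free (F.cls j)
        (S := cl (F.cls j + 1) univ) (fun x hx => (mem_cl.1 hx).2) (k := 0) (by omega)
      refine ⟨Function.update g' j x, ?_, ?_⟩
      · rw [insert_union]
        exact hg'.update hj (mem_cl.1 hxS).2 hxb hxg
      · intro l hl
        rw [Function.update_of_ne, hD l hl]
        rintro rfl
        exact hj (mem_union_right _ hl)
  obtain ⟨g', hg', hD⟩ := key univ
  exact ⟨g', by rwa [union_eq_left.2 (subset_univ D)] at hg', hD⟩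

/-- Changing the choice at a single pair `j` prevents all vertices of parity `cls j` from being
encompassed, on both sides: on either side at most one choice at `j` is harmful. -/
theorem Valid.modify (hm : 5 ≤ m) {g : ι → V m} (h : F.Valid g univ) (j : ι) :
    ∃ x, F.Valid (Function.update g j x) univ ∧ ∀ k v, par v = F.cls j →
      ¬ nbr v ⊆ F.base k ∪ univ.image (Function.update g j x) := by
  classical
  set q := F.cls j with hq
  have hE : F.Valid g (univ.erase j) := h.mono (erase_subset _ _)
  have hj : j ∉ univ.erase j := notMem_erase _ _
  set T : ZMod 2 → Finset (V m) := fun k => cl (q + 1) (F.base k ∪ (univ.erase j).image g) with hT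
  have hTcard : ∀ k, #(T k) < m := by
    intro k
    simp only [hT, cl_union]
    have h1 := card_cl_base_le (F := F) k (q + 1)
    have h2 := hE.card_cl_image_le q
    have h3 := card_inCls_lt hj hq.symm (F := F)
    have h4 := F.card_le k
    have h5 := cnt_add (F := F) q
    have h6 := card_union_le (cl (q + 1) (F.base k)) (cl (q + 1) ((univ.erase j).image g))
    omega
  set bad : ZMod 2 → Finset (V m) := fun k => univ.filter fun x => ∃ v, nbr v ⊆ insert x (T k)
    with hbad
  have hbadcard : ∀ k, #(bad k) ≤ 1 := by
    intro k
    rw [card_le_one]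
    intro x hx y hy
    obtain ⟨v, hv⟩ := (mem_filter.1 hx).2
    obtain ⟨w, hw⟩ := (mem_filter.1 hy).2
    exact eq_of_nbr_subset_insert hm (hTcard k) hv hw
  have hb := free_bound hm hj (F := F) 0
  rw [← hq] at hb
  have hc1 := le_card_sdiff (bad 0 ∪ bad 1) (cl (q + 1) (univ : Finset (V m)))
  have hc2 := card_union_le (bad 0) (bad 1)
  have hc3 := hbadcard 0
  have hc4 := hbadcard 1
  obtain ⟨x, hxS, hxb, hxg⟩ := hE.exists_free q (S := cl (q + 1) univ \ (bad 0 ∪ bad 1))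
    (fun x hx => (mem_cl.1 (mem_sdiff.1 hx).1).2) (k := 0) (by omega)
  obtain ⟨hxq, hxbad⟩ := mem_sdiff.1 hxS
  refine ⟨x, ?_, ?_⟩
  · have := hE.update hj (mem_cl.1 hxq).2 hxb hxg
    rwa [insert_erase (mem_univ j)] at this
  · intro k v hv hsub
    have hxk : x ∉ bad k := by
      rw [mem_union, not_or] at hxbad
      rcases zmod_two_eq_or k 0 with rfl | rfl
      · exact hxbad.1
      · exact hxbad.2
    apply hxk
    refine mem_filter.2 ⟨mem_univ _, v, fun w hw => ?_⟩
    have hpw := par_of_mem_nbr hw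
    rw [hv] at hpw
    rcases mem_union.1 (hsub hw) with h1 | h1
    · exact mem_insert_of_mem (mem_cl.2 ⟨mem_union_left _ h1, hpw⟩)
    · obtain ⟨l, -, rfl⟩ := mem_image.1 h1
      by_cases hl : l = j
      · subst hl
        rw [Function.update_self]
        exact mem_insert_self _ _
      · rw [Function.update_of_ne hl] at hpw ⊢
        exact mem_insert_of_mem (mem_cl.2 ⟨mem_union_right _
          (mem_image_of_mem _ (mem_erase.2 ⟨hl, mem_univ _⟩)), hpw⟩)

/-- The side `k`, completed by `g` on `D`, encompasses no vertex of parity `q` outside it. -/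
def Safe (F : Frame m ι) (g : ι → V m) (D : Finset ι) (k q : ZMod 2) : Prop :=
  ∀ v, par v = q → nbr v ⊆ F.base k ∪ D.image g → v ∈ F.base k ∪ D.image g

theorem Valid.exists_modify (hm : 5 ≤ m) {g : ι → V m} (h : F.Valid g univ) (D : Finset ι)
    (q : ZMod 2) :
    ∃ g', F.Valid g' univ ∧ (∀ j, F.cls j = q + 1 ∨ j ∈ D → g' j = g j) ∧
      ((∃ j, j ∉ D ∧ F.cls j = q) →
        ∀ k v, par v = q → ¬ nbr v ⊆ F.base k ∪ univ.image g') := by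
  by_cases hex : ∃ j, j ∉ D ∧ F.cls j = q
  · obtain ⟨j, hjD, rfl⟩ := hex
    obtain ⟨x, hx, hsafe⟩ := h.modify hm j
    refine ⟨_, hx, ?_, fun _ => hsafe⟩
    rintro l hl
    refine Function.update_of_ne ?_ _ _
    rintro rfl
    exact hl.elim (fun h => zmod_two_add_one_ne _ h.symm) hjD
  · exact ⟨g, h, fun _ _ => rfl, fun h => absurd h hex⟩

/-- A partial choice extends to a total one with no encompassed vertices on the sides in `R`,
provided each class has an untreated pair or is already safe. -/
theorem Valid.exists_safe (hm : 5 ≤ m) {g : ι → V m} {D : Finset ι} (h : F.Valid g D)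
    (R : ZMod 2 → Prop)
    (hR : ∀ q, (∃ j, j ∉ D ∧ F.cls j = q) ∨
      ((∀ j, F.cls j = q → j ∈ D) ∧ ∀ k, R k → F.Safe g D k q)) :
    ∃ g', F.Valid g' univ ∧ (∀ j ∈ D, g' j = g j) ∧ ∀ k, R k → ∀ q, F.Safe g' univ k q := by
  obtain ⟨g₁, hg₁, hD₁⟩ := h.extend hm
  obtain ⟨g₂, hg₂, hD₂, hs₂⟩ := hg₁.exists_modify hm D 0
  obtain ⟨g₃, hg₃, hD₃, hs₃⟩ := hg₂.exists_modify hm D 1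
  have hDg : ∀ j ∈ D, g₃ j = g j := fun j hj => by
    rw [hD₃ j (Or.inr hj), hD₂ j (Or.inr hj), hD₁ j hj]
  have hs : ∀ q, (∃ j, j ∉ D ∧ F.cls j = q) →
      ∀ k v, par v = q → ¬ nbr v ⊆ F.base k ∪ univ.image g₃ := by
    intro q
    rcases zmod_two_eq_or q 1 with rfl | rfl
    · exact hs₃
    · intro hex k v hv hsub
      refine hs₂ hex k v hv (hg₃.nbr_subset_congr (fun j hj => ⟨mem_univ j, ?_⟩) hv hsub)
      exact (hD₃ j (Or.inl hj)).symm
  refine ⟨g₃, hg₃, hDg, fun k hk q v hv hsub => ?_⟩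
  rcases hR q with hex | ⟨hall, hsafe⟩
  · exact absurd hsub (hs q hex k v hv)
  · have h1 := hsafe k hk v hv
      (hg₃.nbr_subset_congr (fun j hj => ⟨hall j hj, (hDg j (hall j hj)).symm⟩) hv hsub)
    rcases mem_union.1 h1 with h2 | h2
    · exact mem_union_left _ h2
    · obtain ⟨j, hj, rfl⟩ := mem_image.1 h2
      exact mem_union_right _ (mem_image.2 ⟨j, mem_univ _, hDg j hj⟩)

end Frame

/-! ### Edge-pairs and encompassed vertices -/

theorem image_subset_image_update {m : ℕ} {ι : Type*} [DecidableEq ι] {g : ι → V m}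
    {D : Finset ι} {j : ι} (hj : j ∉ D) (x : V m) :
    D.image g ⊆ (insert j D).image (Function.update g j x) := by
  intro v hv
  obtain ⟨l, hl, rfl⟩ := mem_image.1 hv
  refine mem_image.2 ⟨l, mem_insert_of_mem hl, Function.update_of_ne ?_ _ _⟩
  rintro rfl
  exact hj hl

namespace Frame

variable {m : ℕ} {ι : Type*} [Fintype ι]

/-- The pairs in `D` that `g` turns into an edge-pair on the side `k`. -/
def edges (F : Frame m ι) (g : ι → V m) (D : Finset ι) (k : ZMod 2) : Finset ι :=
  D.filter fun j => g j ∈ nbr (F.col k j)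

/-- If all crossing pairs have the same class, the vertices of that parity used on the side `k` do
not depend on the completion. A vertex of the other parity that they encompass then has to be used
itself. -/
def Forced (F : Frame m ι) (g : ι → V m) (D : Finset ι) (k : ZMod 2) : Prop :=
  ∀ v, F.cnt (par v) = 0 → nbr v ⊆ F.base k → v ∈ F.base k ∪ D.image g

/-- A record of a partial choice: it makes at least `a` and `b` edge-pairs on the sides `k` and
`k + 1`, and treats `p` and `r` pairs of the classes `q` and `q + 1`. The first edge-pair on a side
is made in such a way that the encompassed vertices of `Forced` are used up. -/
structure Stage (F : Frame m ι) (k q : ZMod 2) (a b p r : ℕ) (g : ι → V m) (D : Finset ι) :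
    Prop where
  valid : F.Valid g D
  le_edges : a ≤ #(F.edges g D k)
  le_edges' : b ≤ #(F.edges g D (k + 1))
  card_inCls : #(F.inCls q D) = p
  card_inCls' : #(F.inCls (q + 1) D) = r
  forced : 1 ≤ a → F.Forced g D k
  forced' : 1 ≤ b → F.Forced g D (k + 1)

/-- Some partial choice has the given record. -/
def Reach (F : Frame m ι) (k q : ZMod 2) (a b p r : ℕ) : Prop := ∃ g D, F.Stage k q a b p r g D

variable {F : Frame m ι}

theorem Stage.init (k q : ZMod 2) (g : ι → V m) : F.Stage k q 0 0 0 0 g ∅ :=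
  ⟨.empty g, Nat.zero_le _, Nat.zero_le _, rfl, rfl, fun h => absurd h (by decide),
    fun h => absurd h (by decide)⟩

theorem Reach.init (k q : ZMod 2) : F.Reach k q 0 0 0 0 := ⟨0, ∅, .init k q 0⟩

theorem Reach.swap_side {k q : ZMod 2} {a b p r : ℕ} (h : F.Reach k q a b p r) :
    F.Reach (k + 1) q b a p r := by
  obtain ⟨g, D, h⟩ := h
  refine ⟨g, D, h.valid, h.le_edges', ?_, h.card_inCls, h.card_inCls', h.forced', ?_⟩ <;>
    rw [zmod_two_add_one_add_one]
  exacts [h.le_edges, h.forced]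

theorem Reach.swap_class {k q : ZMod 2} {a b p r : ℕ} (h : F.Reach k q a b p r) :
    F.Reach k (q + 1) a b r p := by
  obtain ⟨g, D, h⟩ := h
  refine ⟨g, D, h.valid, h.le_edges, h.le_edges', h.card_inCls', ?_, h.forced, h.forced'⟩
  rw [zmod_two_add_one_add_one]
  exact h.card_inCls

theorem cnt_pos (F : Frame m ι) (j : ι) : 0 < F.cnt (F.cls j) :=
  card_pos.2 ⟨j, mem_inCls.2 ⟨mem_univ _, rfl⟩⟩

theorem exists_notMem {D : Finset ι} {q : ZMod 2} (h : #(F.inCls q D) < F.cnt q) :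
    ∃ j, j ∉ D ∧ F.cls j = q := by
  by_contra hcon
  push Not at hcon
  refine h.not_ge (card_le_card fun j hj => ?_)
  have hq := (mem_inCls.1 hj).2
  exact mem_inCls.2 ⟨by_contra fun hj => hcon j hj hq, hq⟩

/-- A total admissible choice that makes at least `a` and `b` edge-pairs on the sides `k` and
`k + 1`, and that leaves no encompassed vertex on a side with `m` pairs. -/
def Solvable (F : Frame m ι) (k : ZMod 2) (a b : ℕ) : Prop :=
  ∃ g, F.Valid g univ ∧ a ≤ #(F.edges g univ k) ∧ b ≤ #(F.edges g univ (k + 1)) ∧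
    ∀ l, F.s l + Fintype.card ι = m → ∀ q, F.Safe g univ l q

theorem Solvable.swap {k : ZMod 2} {a b : ℕ} (h : F.Solvable k a b) : F.Solvable (k + 1) b a := by
  obtain ⟨g, h1, h2, h3, h4⟩ := h
  exact ⟨g, h1, h3, by rwa [zmod_two_add_one_add_one], h4⟩

theorem edges_mono {g g' : ι → V m} {D : Finset ι} (h : ∀ j ∈ D, g' j = g j) (k : ZMod 2) :
    F.edges g D k ⊆ F.edges g' univ k := by
  intro j hj
  obtain ⟨h1, h2⟩ := mem_filter.1 hj
  exact mem_filter.2 ⟨mem_univ _, by rwa [h j h1]⟩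

theorem exists_cnt_le (F : Frame m ι) : ∃ q, F.cnt (q + 1) ≤ F.cnt q := by
  rcases le_total (F.cnt (0 + 1)) (F.cnt 0) with h | h
  · exact ⟨0, h⟩
  · exact ⟨0 + 1, by rwa [zmod_two_add_one_add_one]⟩

variable [DecidableEq ι]

theorem edges_subset_update {g : ι → V m} {D : Finset ι} {j : ι} (hj : j ∉ D) (x : V m)
    (k : ZMod 2) : F.edges g D k ⊆ F.edges (Function.update g j x) (insert j D) k := by
  intro l hl
  obtain ⟨h1, h2⟩ := mem_filter.1 hl
  refine mem_filter.2 ⟨mem_insert_of_mem h1, ?_⟩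
  rwa [Function.update_of_ne]
  rintro rfl
  exact hj h1

theorem Stage.update {k q : ZMod 2} {a b p r : ℕ} {g : ι → V m} {D : Finset ι}
    (h : F.Stage k q a b p r g D) {j : ι} (hj : j ∉ D) (hq : F.cls j = q) {x : V m}
    (hb : ∀ l, x ∉ F.base l) (hg : x ∉ D.image g) (hx : x ∈ nbr (F.col k j))
    (hf : F.Forced (Function.update g j x) (insert j D) k) :
    F.Stage k q (a + 1) b (p + 1) r (Function.update g j x) (insert j D) := by
  have hpar : par x = F.cls j + 1 := by rw [par_of_mem_nbr hx, F.par_col]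
  refine ⟨h.valid.update hj hpar hb hg, ?_, ?_, ?_, ?_, fun _ => hf, fun hb v h1 h2 => ?_⟩
  · have hsub : insert j (F.edges g D k) ⊆
        F.edges (Function.update g j x) (insert j D) k := by
      refine insert_subset (mem_filter.2 ⟨mem_insert_self _ _, ?_⟩) (edges_subset_update hj x k)
      rwa [Function.update_self]
    have := card_le_card hsub
    have hjn : j ∉ F.edges g D k := fun hj' => hj (mem_filter.1 hj').1
    rw [card_insert_of_notMem hjn] at this
    exact (Nat.add_le_add_right h.le_edges 1).trans this
  · exact h.le_edges'.trans (card_le_card (edges_subset_update hj x (k + 1)))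
  · rw [inCls, filter_insert, if_pos hq, card_insert_of_notMem fun hj' => hj (mem_filter.1 hj').1]
    exact congrArg (· + 1) h.card_inCls
  · rw [inCls, filter_insert, if_neg (by rw [hq]; exact (zmod_two_add_one_ne q).symm)]
    exact h.card_inCls'
  · exact union_subset_union_right (image_subset_image_update hj x) (h.forced' hb v h1 h2)

/-- Among two untreated pairs of the same class, one can be completed to an edge-pair on the side
`k`, since their `2 * m - 2` candidates are not all used. -/
theorem Reach.step {k q : ZMod 2} {a b p r : ℕ} (hm : 5 ≤ m)
    (H : ∀ v, F.cnt (par v) = 0 → nbr v ⊆ F.base k → v ∉ F.base k → v ∉ F.base (k + 1))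
    (h : F.Reach k q a b p r) (hp : p + 2 ≤ F.cnt q)
    (hb : F.s k + F.s (k + 1) + 2 * F.cnt (q + 1) + p < 2 * m - 2) :
    F.Reach k q (a + 1) b (p + 1) r := by
  obtain ⟨g, D, h⟩ := h
  have htwo : 1 < #(F.inCls q univ \ F.inCls q D) := by
    have h1 := le_card_sdiff (F.inCls q D) (F.inCls q univ)
    have h2 : #(F.inCls q univ) = F.cnt q := rfl
    have h3 := h.card_inCls
    omega
  have huntreated : ∀ j, j ∈ F.inCls q univ \ F.inCls q D → j ∉ D ∧ F.cls j = q := fun j hj => by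
    obtain ⟨h1, h2⟩ := mem_sdiff.1 hj
    have h3 := (mem_inCls.1 h1).2
    exact ⟨fun hD => h2 (mem_inCls.2 ⟨hD, h3⟩), h3⟩
  obtain ⟨j₁, hj₁, j₂, hj₂, hne⟩ := one_lt_card.1 htwo
  obtain ⟨hD₁, hq₁⟩ := huntreated j₁ hj₁
  obtain ⟨hD₂, hq₂⟩ := huntreated j₂ hj₂
  by_cases hf : F.Forced g D k
  · have hf' : ∀ j, j ∉ D → ∀ x, F.Forced (Function.update g j x) (insert j D) k :=
      fun j hj x v h1 h2 =>
        union_subset_union_right (image_subset_image_update hj x) (hf v h1 h2)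
    have hcard := two_mul_sub_two_le_card_nbr_union ((F.col_injective k).ne hne)
    obtain ⟨x, hx, hxb, hxg⟩ := h.valid.exists_free q
      (S := nbr (F.col k j₁) ∪ nbr (F.col k j₂)) (k := k) (by
        intro x hx
        rcases mem_union.1 hx with h1 | h1 <;> rw [par_of_mem_nbr h1, F.par_col]
        · rw [hq₁]
        · rw [hq₂]) (by rw [h.card_inCls]; omega)
    rcases mem_union.1 hx with h1 | h1
    · exact ⟨_, _, h.update hD₁ hq₁ hxb hxg h1 (hf' _ hD₁ x)⟩
    · exact ⟨_, _, h.update hD₂ hq₂ hxb hxg h1 (hf' _ hD₂ x)⟩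
  · -- The only vertex encompassed on the side `k` has to be chosen; it is adjacent to every
    -- vertex of parity `q` used on that side.
    have hpar : ∀ v : V m, F.cnt (par v) = 0 → par v + 1 = q := by
      intro v hv
      rcases zmod_two_eq_or q (par v) with rfl | h1
      · omega
      · exact h1.symm
    unfold Forced at hf
    push Not at hf
    obtain ⟨v, hv, hsub, hvn⟩ := hf
    rw [mem_union, not_or] at hvn
    have heq : nbr v = cl q (F.base k) := by
      have h1 := nbr_subset_cl hsub
      rw [hpar v hv] at h1
      refine eq_of_subset_of_card_le h1 ?_
      have h2 := card_cl_base_le (F := F) k q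
      have h3 := F.card_le k
      have h4 := cnt_add (F := F) q
      rw [card_nbr]
      omega
    refine ⟨_, _, h.update (x := v) hD₁ hq₁ ?_ hvn.2 ?_ ?_⟩
    · exact notMem_bases_iff.1 (by
        rw [mem_union, not_or]
        exact ⟨hvn.1, H v hv hsub hvn.1⟩)
    · rw [mem_nbr_comm, heq]
      exact mem_cl.2 ⟨col_mem_base k j₁, by rw [F.par_col, hq₁]⟩
    · intro w hw hwsub
      have h1 := nbr_subset_cl hwsub
      rw [hpar w hw, ← heq] at h1
      obtain rfl := eq_of_nbr_subset (by omega) h1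
      exact mem_union_right _ (mem_image.2 ⟨j₁, mem_insert_self _ _, Function.update_self _ _ _⟩)

/-- The same statement with the roles of the classes interchanged. -/
theorem Reach.step_class {k q : ZMod 2} {a b p r : ℕ} (hm : 5 ≤ m)
    (H : ∀ v, F.cnt (par v) = 0 → nbr v ⊆ F.base k → v ∉ F.base k → v ∉ F.base (k + 1))
    (h : F.Reach k q a b p r) (hp : r + 2 ≤ F.cnt (q + 1))
    (hb : F.s k + F.s (k + 1) + 2 * F.cnt q + r < 2 * m - 2) :
    F.Reach k q (a + 1) b p (r + 1) := by
  have := (h.swap_class.step hm H hp (by rwa [zmod_two_add_one_add_one])).swap_class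
  rwa [zmod_two_add_one_add_one] at this

theorem Stage.solvable {k q : ZMod 2} {a b p r : ℕ} {g : ι → V m} {D : Finset ι} (hm : 5 ≤ m)
    (h : F.Stage k q a b p r g D)
    (hR : ∀ q, (∃ j, j ∉ D ∧ F.cls j = q) ∨
      ((∀ j, F.cls j = q → j ∈ D) ∧
        ∀ k, F.s k + Fintype.card ι = m → F.Safe g D k q)) : F.Solvable k a b := by
  obtain ⟨g', h1, h2, h3⟩ := h.valid.exists_safe hm _ hR
  exact ⟨g', h1, h.le_edges.trans (card_le_card (edges_mono h2 k)),
    h.le_edges'.trans (card_le_card (edges_mono h2 (k + 1))), h3⟩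

theorem Reach.solvable {k q : ZMod 2} {a b p r : ℕ} (hm : 5 ≤ m) (h : F.Reach k q a b p r)
    (hp : p < F.cnt q) (hr : r < F.cnt (q + 1) ∨ F.cnt (q + 1) = 0)
    (ha : F.s k + Fintype.card ι = m → 1 ≤ a)
    (hb : F.s (k + 1) + Fintype.card ι = m → 1 ≤ b) : F.Solvable k a b := by
  obtain ⟨g, D, h⟩ := h
  refine h.solvable hm fun q' => ?_
  rcases zmod_two_eq_or q' q with rfl | rfl
  · exact Or.inl (exists_notMem (h.card_inCls.trans_lt hp))
  rcases hr with hr | hr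
  · exact Or.inl (exists_notMem (h.card_inCls'.trans_lt hr))
  have hno : ∀ j, F.cls j ≠ q + 1 := fun j hj => by
    have := F.cnt_pos j
    rw [hj] at this
    omega
  refine Or.inr ⟨fun j hj => absurd hj (hno j), fun l hl v hv hsub => ?_⟩
  have hforced : F.Forced g D l := by
    rcases zmod_two_eq_or l k with rfl | rfl
    · exact h.forced (ha hl)
    · exact h.forced' (hb hl)
  refine hforced v (by rwa [hv]) fun w hw => ?_
  rcases mem_union.1 (hsub hw) with h1 | h1
  · exact h1
  · obtain ⟨j, hj, rfl⟩ := mem_image.1 h1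
    have h2 := par_of_mem_nbr hw
    rw [h.valid.par_eq j hj, hv] at h2
    exact absurd (add_right_cancel h2) (hno j)

/-- Distinct representatives of two sets, not both of them in a given small set. -/
theorem exists_distinct_representatives {α : Type*} [DecidableEq α] {A B C : Finset α}
    (hA : A.Nonempty) (hB : B.Nonempty) (h : 4 ≤ #(A ∪ B)) (hC : #C ≤ 2) :
    ∃ x ∈ A, ∃ y ∈ B, x ≠ y ∧ (x ∉ C ∨ y ∉ C) := by
  have key : ∀ {A B : Finset α}, B.Nonempty → 4 ≤ #(A ∪ B) → ∀ x ∈ A, x ∉ C →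
      ∃ x ∈ A, ∃ y ∈ B, x ≠ y ∧ (x ∉ C ∨ y ∉ C) := by
    intro A B hB h x hx hxC
    by_cases hy : ∃ y ∈ B, x ≠ y
    · obtain ⟨y, hy, hxy⟩ := hy
      exact ⟨x, hx, y, hy, hxy, Or.inl hxC⟩
    push Not at hy
    have hxB : x ∈ B := by
      obtain ⟨y, hyB⟩ := hB
      rwa [hy y hyB]
    have h1 := le_card_sdiff (insert x C) (A ∪ B)
    have h2 := card_insert_le x C
    obtain ⟨z, hz⟩ := card_pos.1 (by omega : 0 < #((A ∪ B) \ insert x C))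
    obtain ⟨hz1, hz2⟩ := mem_sdiff.1 hz
    rw [mem_insert, not_or] at hz2
    refine ⟨z, (mem_union.1 hz1).resolve_right fun hzB => hz2.1 (hy z hzB).symm, x, hxB, hz2.1,
      Or.inl hz2.2⟩
  have h1 := le_card_sdiff C (A ∪ B)
  obtain ⟨x, hx⟩ := card_pos.1 (by omega : 0 < #((A ∪ B) \ C))
  obtain ⟨hx1, hx2⟩ := mem_sdiff.1 hx
  rcases mem_union.1 hx1 with hxA | hxB
  · exact key hB h x hxA hx2
  · obtain ⟨y, hy, z, hz, hne, hyz⟩ := key hA (by rwa [union_comm]) x hxB hx2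
    exact ⟨z, hz, y, hy, hne.symm, hyz.symm⟩

/-- At most two vertices can take part in completing a set of `m - 2` vertices to a full
neighbourhood by two further vertices. -/
theorem exists_card_le_two_of_nbr_subset (hm : 5 ≤ m) {T : Finset (V m)} (hT : #T + 2 ≤ m) :
    ∃ C : Finset (V m), #C ≤ 2 ∧
      ∀ v x y, nbr v ⊆ insert x (insert y T) → x ∈ C ∧ y ∈ C := by
  by_cases hex : ∃ v x y, nbr v ⊆ insert x (insert y T)
  swap
  · push Not at hex
    exact ⟨∅, by simp, fun v x y h => absurd h (hex v x y)⟩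
  have hsdiff : ∀ {v x y}, nbr v ⊆ insert x (insert y T) → nbr v \ T = {x, y} := by
    intro v x y h
    refine eq_of_subset_of_card_le (fun w hw => ?_) ?_
    · obtain ⟨h1, h2⟩ := mem_sdiff.1 hw
      have := h h1
      simp only [mem_insert, mem_singleton] at this ⊢
      tauto
    · have h1 := le_card_sdiff T (nbr v)
      rw [card_nbr] at h1
      have : #({x, y} : Finset (V m)) ≤ 2 := card_le_two
      omega
  have hinter : ∀ {v x y}, nbr v ⊆ insert x (insert y T) → T ⊆ nbr v := by
    intro v x y h
    have h1 := card_sdiff_add_card_inter (nbr v) T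
    have h2 : #({x, y} : Finset (V m)) ≤ 2 := card_le_two
    rw [hsdiff h, card_nbr] at h1
    have h3 := eq_of_subset_of_card_le (inter_subset_right : nbr v ∩ T ⊆ T) (by omega)
    exact inter_eq_right.1 h3
  have hcard : ∀ {v x y}, nbr v ⊆ insert x (insert y T) → m ≤ #T + 2 := by
    intro v x y h
    have h1 := card_le_card h
    have h2 := card_insert_le x (insert y T)
    have h3 := card_insert_le y T
    rw [card_nbr] at h1
    omega
  obtain ⟨v₀, x₀, y₀, h₀⟩ := hex
  refine ⟨{x₀, y₀}, card_le_two, fun v x y h => ?_⟩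
  have heq : v = v₀ := by
    by_contra hne
    have h1 := card_nbr_inter_le hne
    have h2 := card_le_card (subset_inter (hinter h) (hinter h₀))
    have h3 := hcard h
    omega
  subst heq
  rw [← hsdiff h₀, hsdiff h]
  simp

theorem exists_solution (F : Frame m ι) (hm : 5 ≤ m) (h : ∀ k, F.s k + Fintype.card ι < m) :
    F.Solvable 0 0 0 := by
  obtain ⟨g, hg, -⟩ := (Valid.empty (F := F) 0).extend hm
  exact ⟨g, hg, Nat.zero_le _, Nat.zero_le _, fun l hl => absurd hl (h l).ne⟩

/-- With two crossing pairs of one class and one of the other, the two edge-pairs on the side `k`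
have to be made from the first two, and their two new vertices must avoid completing a
neighbourhood. -/
theorem solvable_of_cnt_two_one (hm : 5 ≤ m) {k q : ZMod 2} (hk : F.s k + 3 = m)
    (hk' : F.s (k + 1) = 0) (hq : F.cnt q = 2) (hq' : F.cnt (q + 1) = 1) : F.Solvable k 2 0 := by
  have hcard := cnt_add (F := F) q
  obtain ⟨j₁, hj₁, j₂, hj₂, hne⟩ := one_lt_card.1 (hq.symm ▸ Nat.one_lt_two : 1 < F.cnt q)
  have hq₁ := (mem_inCls.1 hj₁).2
  have hq₂ := (mem_inCls.1 hj₂).2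
  have hall : ∀ j, F.cls j = q → j ∈ ({j₂, j₁} : Finset ι) := by
    have : ({j₂, j₁} : Finset ι) = F.inCls q univ := by
      refine eq_of_subset_of_card_le ?_ ?_
      · rw [insert_subset_iff, singleton_subset_iff]
        exact ⟨hj₂, hj₁⟩
      · rw [card_pair hne.symm]
        exact hq.le
    intro j hj
    rw [this]
    exact mem_inCls.2 ⟨mem_univ _, hj⟩
  set W := cl (q + 1) (F.base k ∪ F.base (k + 1)) with hW
  have hWcard : #W + 1 ≤ m := by
    rw [hW]
    have := card_cl_bases_le (F := F) k (q + 1)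
    omega
  have hTcard : #(cl (q + 1) (F.base k)) + 2 ≤ m := by
    have := card_cl_base_le (F := F) k (q + 1)
    omega
  obtain ⟨C, hC, hCT⟩ := exists_card_le_two_of_nbr_subset hm hTcard
  have hpos : ∀ j, (nbr (F.col k j) \ W).Nonempty := by
    intro j
    have := le_card_sdiff W (nbr (F.col k j))
    rw [card_nbr] at this
    exact card_pos.1 (by omega)
  obtain ⟨x, hx, y, hy, hxy, hxyC⟩ :=
    exists_distinct_representatives (hpos j₁) (hpos j₂) (by
      rw [← union_sdiff_distrib]
      have h1 := le_card_sdiff W (nbr (F.col k j₁) ∪ nbr (F.col k j₂))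
      have h2 := two_mul_sub_two_le_card_nbr_union ((F.col_injective k).ne hne)
      omega) hC
  have hfree : ∀ j x, F.cls j = q → x ∈ nbr (F.col k j) \ W → ∀ l, x ∉ F.base l := by
    intro j x hj hx
    obtain ⟨h1, h2⟩ := mem_sdiff.1 hx
    refine notMem_bases_iff (k := k).1 fun hb => h2 (mem_cl.2 ⟨hb, ?_⟩)
    rw [par_of_mem_nbr h1, F.par_col, hj]
  have hforced : ∀ g D, F.Forced g D k := by
    intro g D v hv
    rcases zmod_two_eq_or (par v) q with h | h <;> rw [h] at hv <;> omega
  have hst := (Stage.init (F := F) k q 0).update (notMem_empty j₁) hq₁ (hfree j₁ x hq₁ hx)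
    (by simp) (mem_sdiff.1 hx).1 (hforced _ _)
  rw [insert_empty_eq] at hst
  have hst' := hst.update (x := y) (j := j₂) (by simpa using hne.symm) hq₂ (hfree j₂ y hq₂ hy)
    (by simpa using hxy.symm) (mem_sdiff.1 hy).1 (hforced _ _)
  refine hst'.solvable hm fun q' => ?_
  rcases zmod_two_eq_or q' q with rfl | rfl
  · refine Or.inr ⟨hall, fun l hl v hv hsub => ?_⟩
    rcases zmod_two_eq_or l k with rfl | rfl
    · exfalso
      have h1 : nbr v ⊆ insert x (insert y (cl (q' + 1) (F.base l))) := by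
        intro w hw
        rcases mem_union.1 (hsub hw) with h1 | h1
        · refine mem_insert_of_mem (mem_insert_of_mem (mem_cl.2 ⟨h1, ?_⟩))
          rw [par_of_mem_nbr hw, hv]
        · have : w = y ∨ w = x := by
            simpa [Function.update_of_ne hne, eq_comm] using h1
          rcases this with rfl | rfl <;> simp
      obtain ⟨h2, h3⟩ := hCT _ _ _ h1
      exact hxyC.elim (fun h => h h2) fun h => h h3
    · omega
  · refine Or.inl (exists_notMem ?_)
    rw [hst'.card_inCls', hq']
    exact Nat.zero_lt_one

/-- The side `k` holds all non-crossing pairs. -/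
theorem solvable_of_one_side (hm : 5 ≤ m) {k : ZMod 2} (hk : F.s k + Fintype.card ι = m)
    (hpos : 0 < F.s k) (hk' : F.s (k + 1) = 0) (hc : 3 ≤ Fintype.card ι)
    (H : ∀ v, F.cnt (par v) = 0 → nbr v ⊆ F.base k → v ∉ F.base k → v ∉ F.base (k + 1)) :
    F.Solvable k 2 0 := by
  obtain ⟨q, hq⟩ := F.exists_cnt_le
  have hcard := cnt_add (F := F) q
  rcases (by omega : 3 ≤ F.cnt q ∨ (F.cnt q = 2 ∧ F.cnt (q + 1) = 2) ∨
    (F.cnt q = 2 ∧ F.cnt (q + 1) = 1)) with h | ⟨h1, h2⟩ | ⟨h1, h2⟩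
  · exact (((Reach.init k q).step hm H (by omega) (by omega)).step hm H (by omega)
      (by omega)).solvable hm (by omega) (by omega) (by omega) (by omega)
  · exact (((Reach.init k q).step hm H (by omega) (by omega)).step_class hm H (by omega)
      (by omega)).solvable hm (by omega) (by omega) (by omega) (by omega)
  · exact solvable_of_cnt_two_one hm (by omega) hk' h1 h2

/-- The side `k + 1` holds a single non-crossing pair, the side `k` holds more. -/
theorem solvable_of_lone_pair (hm : 5 ≤ m) {k : ZMod 2} (hk : F.s k + Fintype.card ι = m)
    (hpos : 2 ≤ F.s k) (hk' : F.s (k + 1) = 1) (hc : 3 ≤ Fintype.card ι)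
    (H : ∀ v, F.cnt (par v) = 0 → nbr v ⊆ F.base k → v ∉ F.base k → v ∉ F.base (k + 1)) :
    F.Solvable k 1 0 := by
  obtain ⟨q, hq⟩ := F.exists_cnt_le
  have hcard := cnt_add (F := F) q
  exact ((Reach.init k q).step hm H (by omega) (by omega)).solvable hm (by omega) (by omega)
    (by omega) (by omega)

/-- Each side holds a single non-crossing pair. -/
theorem solvable_of_two_lone_pairs (hm : 5 ≤ m) {k : ZMod 2} (hk : F.s k = 1)
    (hk' : F.s (k + 1) = 1) (hc : Fintype.card ι + 1 = m)
    (H : ∀ k v, F.cnt (par v) = 0 → nbr v ⊆ F.base k → v ∉ F.base k → v ∉ F.base (k + 1)) :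
    F.Solvable k 1 1 := by
  obtain ⟨q, hq⟩ := F.exists_cnt_le
  have hcard := cnt_add (F := F) q
  have h1 := ((Reach.init k q).step hm (H k) (by omega) (by omega)).swap_side
  have hk2 : F.s (k + 1 + 1) = 1 := by rwa [zmod_two_add_one_add_one]
  have : F.Solvable (k + 1) 1 1 := by
    rcases (by omega : 3 ≤ F.cnt q ∨ (F.cnt q = 2 ∧ F.cnt (q + 1) = 2)) with h | ⟨h, h'⟩
    · exact (h1.step hm (H _) (by omega) (by omega)).solvable hm (by omega) (by omega) (by omega)
        (by omega)
    · exact (h1.step_class hm (H _) (by omega) (by omega)).solvable hm (by omega) (by omega)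
        (by omega) (by omega)
  have := this.swap
  rwa [zmod_two_add_one_add_one] at this

/-- All pairs cross. -/
theorem solvable_of_all_crossing (hm : 5 ≤ m) (heven : Even m) {k : ZMod 2} (hk : F.s k = 0)
    (hk' : F.s (k + 1) = 0) (hc : Fintype.card ι = m)
    (H : ∀ k v, F.cnt (par v) = 0 → nbr v ⊆ F.base k → v ∉ F.base k → v ∉ F.base (k + 1)) :
    F.Solvable k 2 2 := by
  obtain ⟨t, ht⟩ := heven
  obtain ⟨q, hq⟩ := F.exists_cnt_le
  have hcard := cnt_add (F := F) q
  have h1 := (((Reach.init k q).step hm (H k) (by omega) (by omega)).step hm (H k) (by omega)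
    (by omega)).swap_side
  have hk2 : F.s (k + 1 + 1) = 0 := by rwa [zmod_two_add_one_add_one]
  have : F.Solvable (k + 1) 2 2 := by
    rcases (by omega : 5 ≤ F.cnt q ∨ (3 ≤ F.cnt q ∧ 3 ≤ F.cnt (q + 1)) ∨
      (F.cnt q = 4 ∧ F.cnt (q + 1) = 2)) with h | ⟨h, h'⟩ | ⟨h, h'⟩
    · exact ((h1.step hm (H _) (by omega) (by omega)).step hm (H _) (by omega)
        (by omega)).solvable hm (by omega) (by omega) (by omega) (by omega)
    · exact ((h1.step_class hm (H _) (by omega) (by omega)).step_class hm (H _) (by omega)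
        (by omega)).solvable hm (by omega) (by omega) (by omega) (by omega)
    · exact ((h1.step hm (H _) (by omega) (by omega)).step_class hm (H _) (by omega)
        (by omega)).solvable hm (by omega) (by omega) (by omega) (by omega)
  have := this.swap
  rwa [zmod_two_add_one_add_one] at this

end Frame

/-! ### Projection along a coordinate and completions -/

section Projection

variable {m : ℕ}

/-- Deletion of the `i`-th coordinate, with values in `V m`. -/
def proj (i : Fin (m + 1)) (v : V (m + 1)) : V m := fun j => v (i.succAbove j)

/-- Insertion of the value `k` at the coordinate `i`. -/
def ins (i : Fin (m + 1)) (k : ZMod 2) (w : V m) : V (m + 1) :=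
  Fin.insertNth (α := fun _ => ZMod 2) i k w

theorem del_eq_proj (i : Fin (m + 1)) : (del i : V (m + 1) → V m) = proj i := by
  funext v j
  simp only [del, proj, Fin.succAbove, Fin.lt_def, Fin.val_castSucc]
  split_ifs <;> rfl

@[simp] theorem ins_apply (i : Fin (m + 1)) (k : ZMod 2) (w : V m) : ins i k w i = k := by
  simp [ins]

@[simp] theorem proj_ins (i : Fin (m + 1)) (k : ZMod 2) (w : V m) : proj i (ins i k w) = w := by
  funext j
  simp [ins, proj]

theorem ext_proj {i : Fin (m + 1)} {v w : V (m + 1)} (h : v i = w i)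
    (hp : proj i v = proj i w) : v = w := by
  funext j
  induction j using Fin.succAboveCases i with
  | x => exact h
  | p j => exact congrFun hp j

theorem ins_proj {i : Fin (m + 1)} {k : ZMod 2} {v : V (m + 1)} (h : v i = k) :
    ins i k (proj i v) = v :=
  ext_proj (i := i) (by rw [ins_apply, h]) (proj_ins i k _)

theorem proj_add (i : Fin (m + 1)) (v w : V (m + 1)) : proj i (v + w) = proj i v + proj i w := rfl

theorem proj_e_self (i : Fin (m + 1)) : proj i (e i) = 0 := by
  funext j
  exact e_of_ne (Fin.succAbove_ne i j)

theorem proj_e_succAbove (i : Fin (m + 1)) (j : Fin m) :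
    proj i (e (i.succAbove j)) = e j := by
  funext l
  by_cases h : l = j
  · subst h
    exact (e_self _).trans (e_self _).symm
  · exact (e_of_ne (fun h' => h (Fin.succAbove_right_injective h'))).trans (e_of_ne h).symm

theorem ins_add_e (i : Fin (m + 1)) (k : ZMod 2) (w : V m) :
    ins i k w + e i = ins i (k + 1) w :=
  ext_proj (i := i) (by simp [e_self]) (by simp [proj_add, proj_e_self])

theorem ins_add_e_succAbove (i : Fin (m + 1)) (k : ZMod 2) (w : V m) (j : Fin m) :
    ins i k w + e (i.succAbove j) = ins i k (w + e j) :=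
  ext_proj (i := i) (by simp [e_of_ne (Fin.succAbove_ne i j).symm])
    (by simp [proj_add, proj_e_succAbove])

theorem par_eq_add_par_proj (i : Fin (m + 1)) (v : V (m + 1)) : par v = v i + par (proj i v) :=
  Fin.sum_univ_succAbove _ i

theorem proj_mem_nbr {i : Fin (m + 1)} {v w : V (m + 1)} (h : v i = w i) (hw : w ∈ nbr v) :
    proj i w ∈ nbr (proj i v) := by
  obtain ⟨l, rfl⟩ := mem_nbr.1 hw
  induction l using Fin.succAboveCases i with
  | x =>
    rw [Pi.add_apply, e_self] at h
    exact absurd h.symm (zmod_two_add_one_ne _)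
  | p j => exact mem_nbr.2 ⟨j, by rw [proj_add, proj_e_succAbove]⟩

theorem isOddPair_mk {n : ℕ} {v w : V n} : IsOddPair s(v, w) ↔ par v ≠ par w := by
  simp [IsOddPair, chi_eq_chi_iff]

theorem isEdgePair_mk {n : ℕ} {v w : V n} : IsEdgePair s(v, w) ↔ w ∈ nbr v := by
  rw [← adj_iff_mem_nbr]
  exact SimpleGraph.mem_edgeSet _

theorem IsOddPair.not_isDiag {n : ℕ} {p : Pair n} (h : IsOddPair p) : ¬ p.IsDiag := by
  induction p using Sym2.ind with | _ v w
  exact fun hd => isOddPair_mk.1 h (congrArg par (Sym2.mk_isDiag_iff.1 hd))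

theorem IsOddPair.pairChi_eq_zero {n : ℕ} {p : Pair n} (h : IsOddPair p) : pairChi p = 0 := by
  induction p using Sym2.ind with | _ v w
  have key : ∀ x y : ZMod 2, x ≠ y → (-1 : ℤ) ^ x.val + (-1) ^ y.val = 0 := by decide
  change chi v + chi w = 0
  rw [chi_eq_par, chi_eq_par]
  exact key _ _ (isOddPair_mk.1 h)

theorem IsOdd.isBalanced {n : ℕ} {A : Finset (Pair n)} (hA : IsOdd A) : IsBalanced A :=
  ⟨hA.1, sum_eq_zero fun p hp => (hA.2 p hp).pairChi_eq_zero⟩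

theorem IsOdd.eq_of_mem {n : ℕ} {A : Finset (Pair n)} (hA : IsOdd A) {p q : Pair n} (hp : p ∈ A)
    (hq : q ∈ A) {v : V n} (hvp : v ∈ p) (hvq : v ∈ q) : p = q :=
  by_contra fun hne => hA.1.1 p hp q hq hne v hvp hvq

theorem isOdd_of_eq_of_mem {n : ℕ} {A : Finset (Pair n)} (h : ∀ p ∈ A, IsOddPair p)
    (huniq : ∀ p ∈ A, ∀ q ∈ A, ∀ v, v ∈ p → v ∈ q → p = q) : IsOdd A :=
  ⟨⟨fun p hp q hq hne v hvp hvq => hne (huniq p hp q hq v hvp hvq),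
    fun ⟨p, hp⟩ => ⟨p, hp, (h p hp).not_isDiag⟩⟩, h⟩

/-- The pairs of `A` whose two vertices differ in the coordinate `i`. -/
noncomputable def crossing {n : ℕ} (i : Fin n) (A : Finset (Pair n)) : Finset (Pair n) :=
  A \ (side i 0 A ∪ side i 1 A)

theorem mem_side {n : ℕ} {i : Fin n} {k : ZMod 2} {A : Finset (Pair n)} {p : Pair n} :
    p ∈ side i k A ↔ p ∈ A ∧ ∀ v ∈ p, v i = k := by
  simp [side]

theorem exists_mem {n : ℕ} (p : Pair n) : ∃ v, v ∈ p := by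
  induction p using Sym2.ind with | _ v w
  exact ⟨v, Sym2.mem_mk_left v w⟩

theorem mem_crossing {n : ℕ} {i : Fin n} {A : Finset (Pair n)} {p : Pair n} :
    p ∈ crossing i A ↔ p ∈ A ∧ ∀ k, ∃ v ∈ p, v i = k := by
  rw [crossing, mem_sdiff, mem_union, mem_side, mem_side]
  refine and_congr_right fun hp => ?_
  simp only [hp, true_and, not_or, not_forall, exists_prop]
  constructor
  · rintro ⟨⟨v, hv, hv0⟩, w, hw, hw1⟩ k
    rcases zmod_two_eq_or k 0 with rfl | rfl
    · exact ⟨w, hw, zmod_two_ne_iff.1 hw1⟩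
    · exact ⟨v, hv, zmod_two_ne_iff.1 hv0⟩
  · intro h
    obtain ⟨v, hv, hv0⟩ := h 0
    obtain ⟨w, hw, hw1⟩ := h 1
    exact ⟨⟨w, hw, by rw [hw1]; decide⟩, v, hv, by rw [hv0]; decide⟩

theorem card_side_add_card_crossing {n : ℕ} (i : Fin n) (A : Finset (Pair n)) :
    sigma i 0 A + sigma i 1 A + #(crossing i A) = #A := by
  have hdisj : Disjoint (side i 0 A) (side i 1 A) := by
    rw [disjoint_left]
    intro p hp hp'
    obtain ⟨v, hv⟩ := exists_mem p
    have h := ((mem_side.1 hp).2 v hv).symm.trans ((mem_side.1 hp').2 v hv)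
    exact absurd h (by decide)
  have hsub : side i 0 A ∪ side i 1 A ⊆ A :=
    union_subset (filter_subset _ _) (filter_subset _ _)
  rw [sigma, sigma, ← card_union_of_disjoint hdisj, crossing, add_comm]
  exact card_sdiff_add_card_eq_card hsub

theorem card_side_add_card_crossing' {n : ℕ} (i : Fin n) (A : Finset (Pair n)) (k : ZMod 2) :
    sigma i k A + sigma i (k + 1) A + #(crossing i A) = #A := by
  rcases zmod_two_eq_or k 0 with rfl | rfl
  · exact card_side_add_card_crossing i A
  · rw [zmod_two_add_one_add_one, add_comm (sigma i _ A)]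
    exact card_side_add_card_crossing i A

/-- The vertex of a crossing pair on the side `k`. -/
noncomputable def vtx {n : ℕ} {i : Fin n} {A : Finset (Pair n)} (k : ZMod 2)
    (j : {p // p ∈ crossing i A}) : V n := ((mem_crossing.1 j.2).2 k).choose

section vtx

variable {n : ℕ} {i : Fin n} {A : Finset (Pair n)} (k : ZMod 2) (j : {p // p ∈ crossing i A})

theorem vtx_mem : vtx k j ∈ j.1 := ((mem_crossing.1 j.2).2 k).choose_spec.1

@[simp] theorem vtx_apply : vtx k j i = k := ((mem_crossing.1 j.2).2 k).choose_spec.2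

theorem crossing_mem : j.1 ∈ A := (mem_crossing.1 j.2).1

theorem crossing_eq_mk : j.1 = s(vtx k j, vtx (k + 1) j) := by
  refine (Sym2.mem_and_mem_iff fun h => ?_).1 ⟨vtx_mem k j, vtx_mem (k + 1) j⟩
  have := congrFun h i
  rw [vtx_apply, vtx_apply] at this
  exact zmod_two_add_one_ne k this.symm

variable {k} {j} in
theorem eq_vtx_of_mem {v : V n} (hv : v ∈ j.1) (hk : v i = k) : v = vtx k j := by
  rw [crossing_eq_mk k j, Sym2.mem_iff] at hv
  refine hv.resolve_right fun h => zmod_two_add_one_ne k ?_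
  rw [h, vtx_apply] at hk
  exact hk

end vtx

theorem par_proj_vtx_add_one {i : Fin (m + 1)} {A : Finset (Pair (m + 1))} (hA : IsOdd A)
    (k : ZMod 2) (j : {p // p ∈ crossing i A}) :
    par (proj i (vtx (k + 1) j)) = par (proj i (vtx k j)) := by
  have h := hA.2 _ (crossing_mem j)
  rw [crossing_eq_mk k j, isOddPair_mk, par_eq_add_par_proj i,
    par_eq_add_par_proj i (vtx (k + 1) j), vtx_apply, vtx_apply] at h
  have key : ∀ k x y : ZMod 2, k + x ≠ k + 1 + y → y = x := by decide
  exact key _ _ _ h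

/-- The vertices of the pairs on the side `k`, projected along `i`. -/
noncomputable def sideVerts (i : Fin (m + 1)) (k : ZMod 2) (A : Finset (Pair (m + 1))) :
    Finset (V m) :=
  (side i k A).biUnion fun p => p.toFinset.image (proj i)

theorem mem_sideVerts {i : Fin (m + 1)} {k : ZMod 2} {A : Finset (Pair (m + 1))} {w : V m} :
    w ∈ sideVerts i k A ↔ ∃ p ∈ side i k A, ins i k w ∈ p := by
  rw [sideVerts, mem_biUnion]
  refine exists_congr fun p => and_congr_right fun hp => ?_
  rw [mem_image]
  constructor
  · rintro ⟨v, hv, rfl⟩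
    rw [Sym2.mem_toFinset] at hv
    rwa [ins_proj ((mem_side.1 hp).2 v hv)]
  · exact fun h => ⟨_, Sym2.mem_toFinset.2 h, proj_ins i k w⟩

theorem card_cl_sideVerts_le {A : Finset (Pair (m + 1))} (hA : IsOdd A) (i : Fin (m + 1))
    (k q : ZMod 2) : #(cl q (sideVerts i k A)) ≤ sigma i k A := by
  rw [sideVerts, cl, filter_biUnion]
  refine (card_biUnion_le_card_mul _ _ 1 fun p hp => ?_).trans (mul_one _).le
  obtain ⟨hpA, hpk⟩ := mem_side.1 hp
  rw [card_le_one]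
  have hodd := hA.2 p hpA
  induction p using Sym2.ind with | _ a b
  rw [isOddPair_mk, par_eq_add_par_proj i, par_eq_add_par_proj i b,
    hpk a (Sym2.mem_mk_left _ _), hpk b (Sym2.mem_mk_right _ _)] at hodd
  have hodd' : par (proj i a) ≠ par (proj i b) := fun h => hodd (by rw [h])
  intro x hx y hy
  simp only [mem_filter, mem_image, Sym2.mem_toFinset, Sym2.mem_iff] at hx hy
  obtain ⟨⟨x, rfl | rfl, rfl⟩, hx⟩ := hx <;> obtain ⟨⟨y, rfl | rfl, rfl⟩, hy⟩ := hy
  · rfl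
  · exact absurd (hx.trans hy.symm) hodd'
  · exact absurd (hy.trans hx.symm) hodd'
  · rfl

/-- The frame obtained by projecting `A` along the coordinate `i`. -/
noncomputable def frame (i : Fin (m + 1)) {A : Finset (Pair (m + 1))} (hA : IsOdd A)
    (hle : ∀ k, sigma i k A + #(crossing i A) ≤ m) (hadd : #A ≤ m + 1) :
    Frame m {p // p ∈ crossing i A} where
  X k := sideVerts i k A
  col k j := proj i (vtx k j)
  cls j := par (proj i (vtx 0 j))
  s k := sigma i k A
  col_injective k j j' h := by
    have hv : vtx k j = vtx k j' := ext_proj (by simp) h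
    exact Subtype.ext (hA.eq_of_mem (crossing_mem j) (crossing_mem j') (vtx_mem k j)
      (hv ▸ vtx_mem k j'))
  par_col k j := by
    rcases zmod_two_eq_or k 0 with rfl | rfl
    · rfl
    · exact par_proj_vtx_add_one hA 0 j
  card_X k q := card_cl_sideVerts_le hA i k q
  card_le k := by simpa using hle k
  card_add_le k := by
    rw [Fintype.card_coe, card_side_add_card_crossing']
    exact hadd

section completion

variable {i : Fin (m + 1)} {A : Finset (Pair (m + 1))} {hA : IsOdd A}
  {hle : ∀ k, sigma i k A + #(crossing i A) ≤ m} {hadd : #A ≤ m + 1}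

theorem mem_base_frame {k : ZMod 2} {w : V m} :
    w ∈ (frame i hA hle hadd).base k ↔ ins i k w ∈ verts A := by
  rw [Frame.mem_base]
  constructor
  · rintro (h | ⟨j, rfl⟩)
    · obtain ⟨p, hp, hw⟩ := mem_sideVerts.1 h
      exact ⟨p, (mem_side.1 hp).1, hw⟩
    · refine ⟨j.1, crossing_mem j, ?_⟩
      change ins i k (proj i (vtx k j)) ∈ j.1
      rw [ins_proj (vtx_apply k j)]
      exact vtx_mem k j
  · rintro ⟨p, hp, hw⟩
    by_cases hk : ∀ v ∈ p, v i = k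
    · exact Or.inl (mem_sideVerts.2 ⟨p, mem_side.2 ⟨hp, hk⟩, hw⟩)
    · push Not at hk
      obtain ⟨v, hv, hvk⟩ := hk
      refine Or.inr ⟨⟨p, mem_crossing.2 ⟨hp, fun l => ?_⟩⟩, ?_⟩
      · rcases zmod_two_eq_or l k with rfl | rfl
        · exact ⟨_, hw, ins_apply i l w⟩
        · exact ⟨v, hv, zmod_two_ne_iff.1 hvk⟩
      · change proj i (vtx k _) = w
        rw [← eq_vtx_of_mem (j := ⟨p, _⟩) hw (ins_apply i k w), proj_ins]

/-- The pairs of a completion that replace a pair of `A`. -/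
noncomputable def piece (g : {p // p ∈ crossing i A} → V m) (p : Pair (m + 1)) :
    Finset (Pair (m + 1)) :=
  if h : p ∈ crossing i A then
    {s(vtx 0 ⟨p, h⟩, ins i 0 (g ⟨p, h⟩)), s(ins i 1 (g ⟨p, h⟩), vtx 1 ⟨p, h⟩)}
  else {p}

theorem mem_piece_of_mem_crossing {g : {p // p ∈ crossing i A} → V m}
    (j : {p // p ∈ crossing i A}) {q : Pair (m + 1)} :
    q ∈ piece g j.1 ↔ ∃ k, q = s(vtx k j, ins i k (g j)) := by
  rw [piece, dif_pos j.2, mem_insert, mem_singleton, Sym2.eq_swap (a := ins i 1 (g j))]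
  constructor
  · rintro (h | h)
    exacts [⟨0, h⟩, ⟨1, h⟩]
  · rintro ⟨k, h⟩
    rcases zmod_two_eq_or k 0 with rfl | rfl
    exacts [Or.inl h, Or.inr h]

theorem mem_biUnion_piece {g : {p // p ∈ crossing i A} → V m} {S : Finset (Pair (m + 1))}
    {q : Pair (m + 1)} : q ∈ S.biUnion (piece g) ↔
      (q ∈ S ∧ q ∉ crossing i A) ∨ ∃ j : {p // p ∈ crossing i A}, j.1 ∈ S ∧
        ∃ k, q = s(vtx k j, ins i k (g j)) := by
  rw [mem_biUnion]
  constructor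
  · rintro ⟨p, hp, hq⟩
    by_cases h : p ∈ crossing i A
    · exact Or.inr ⟨⟨p, h⟩, hp, (mem_piece_of_mem_crossing ⟨p, h⟩).1 hq⟩
    · rw [piece, dif_neg h, mem_singleton] at hq
      exact Or.inl (hq ▸ ⟨hp, h⟩)
  · rintro (⟨hq, h⟩ | ⟨j, hj, h⟩)
    · exact ⟨q, hq, by rw [piece, dif_neg h]; exact mem_singleton_self q⟩
    · exact ⟨j.1, hj, (mem_piece_of_mem_crossing j).2 h⟩

theorem par_col_ne_par {g : {p // p ∈ crossing i A} → V m}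
    (hg : (frame i hA hle hadd).Valid g univ) (k : ZMod 2) (j : {p // p ∈ crossing i A}) :
    par (proj i (vtx k j)) ≠ par (g j) := by
  rw [hg.par_eq j (mem_univ _), ← (frame i hA hle hadd).par_col k j]
  exact (zmod_two_add_one_ne _).symm

/-- The new vertices of a pair are still unused when the other pairs in `S` have been treated. -/
theorem ins_notMem_of_valid {g : {p // p ∈ crossing i A} → V m}
    (hg : (frame i hA hle hadd).Valid g univ) {S : Finset (Pair (m + 1))} (hS : S ⊆ A)
    {j : {p // p ∈ crossing i A}} (hj : j.1 ∉ S) (k : ZMod 2) :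
    ins i k (g j) ∉ verts A ∪ verts (S.biUnion (piece g)) := by
  have hbase : ins i k (g j) ∉ verts A := fun h =>
    hg.notMem j (mem_univ _) k (mem_base_frame.2 h)
  rintro (h | ⟨q, hq, hv⟩)
  · exact hbase h
  · rcases mem_biUnion_piece.1 hq with ⟨hqS, -⟩ | ⟨j', hj', l, rfl⟩
    · exact hbase ⟨q, hS hqS, hv⟩
    · rcases Sym2.mem_iff.1 hv with h | h
      · exact hbase (h ▸ ⟨j'.1, crossing_mem j', vtx_mem l j'⟩)
      · have := congrArg (proj i) h
        rw [proj_ins, proj_ins] at this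
        rw [hg.injOn (mem_coe.2 (mem_univ _)) (mem_coe.2 (mem_univ _)) this] at hj
        exact hj hj'

/-- An admissible choice of new vertices yields a run of the construction of completions. -/
theorem isSimpleCompletion_biUnion_piece {g : {p // p ∈ crossing i A} → V m}
    (hg : (frame i hA hle hadd).Valid g univ) :
    IsSimpleCompletion i A (A.biUnion (piece g)) := by
  have hnoteven : ∀ p ∈ A, ¬ IsEvenPair p := hA.2
  refine ⟨hA.isBalanced, ∅, ⟨by simp, by simp, fun p hp h => absurd h (hnoteven p hp), by simp,
    by simp⟩, ?_⟩
  have key : ∀ S : Finset (Pair (m + 1)), S ⊆ A →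
      Relation.ReflTransGen (Step i A ∅) (∅, A) (S.biUnion (piece g), A \ S) := by
    intro S
    induction S using Finset.induction_on with
    | empty => intro _; simpa using Relation.ReflTransGen.refl
    | insert p S hpS ih =>
      intro hS
      obtain ⟨hpA, hSA⟩ := insert_subset_iff.1 hS
      refine (ih hSA).tail ?_
      have hmem : p ∈ A \ S := mem_sdiff.2 ⟨hpA, hpS⟩
      have hodd := hA.2 p hpA
      have hsd : A \ insert p S = (A \ S) \ {p} := by
        rw [insert_eq, union_comm, sdiff_sdiff_left]
        rfl
      rw [biUnion_insert, union_comm, hsd]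
      by_cases hp : p ∈ crossing i A
      · have heq : p = s(vtx 0 ⟨p, hp⟩, vtx 1 ⟨p, hp⟩) := crossing_eq_mk 0 ⟨p, hp⟩
        have h0 := ins_notMem_of_valid hg hSA (j := ⟨p, hp⟩) hpS 0
        have h1 := ins_notMem_of_valid hg hSA (j := ⟨p, hp⟩) hpS 1
        have hpar := par_col_ne_par hg 0 ⟨p, hp⟩
        have hadd' : ins i 0 (g ⟨p, hp⟩) + e i = ins i 1 (g ⟨p, hp⟩) := by
          rw [ins_add_e, zero_add]
        have hstep := Step.oddCross (i := i) (A := A) (R := ∅) (S.biUnion (piece g)) (A \ S)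
          (vtx 0 ⟨p, hp⟩) (vtx 1 ⟨p, hp⟩) (ins i 0 (g ⟨p, hp⟩)) (by rwa [← heq])
          (by rwa [← heq]) (by simp) (by simp)
          (by
            rw [Ne, chi_eq_chi_iff, par_eq_add_par_proj i, par_eq_add_par_proj i (ins _ _ _)]
            simpa using hpar)
          ⟨h0, by rwa [hadd']⟩
        rw [hadd', ← heq] at hstep
        rw [piece, dif_pos hp]
        exact hstep
      · rw [piece, dif_neg hp]
        induction p using Sym2.ind with | _ a b
        refine Step.oddSame _ _ a b hmem hodd ?_
        by_contra hab
        refine hp (mem_crossing.2 ⟨hpA, fun k => ?_⟩)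
        rcases zmod_two_eq_or k (a i) with rfl | rfl
        · exact ⟨a, Sym2.mem_mk_left _ _, rfl⟩
        · exact ⟨b, Sym2.mem_mk_right _ _, zmod_two_ne_iff.1 (Ne.symm hab)⟩
  have := key A subset_rfl
  rwa [sdiff_self] at this

theorem rho_biUnion_piece (g : {p // p ∈ crossing i A} → V m) (k : ZMod 2) :
    (rho i k (A.biUnion (piece g)) : Finset (Pair m)) =
      (side i k A).image (Sym2.map (proj i)) ∪ univ.image fun j => s(proj i (vtx k j), g j) := by
  ext p
  have h1 : p ∈ (rho i k (A.biUnion (piece g)) : Finset (Pair m)) ↔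
      ∃ q ∈ side i k (A.biUnion (piece g)), Sym2.map (proj i) q = p := by
    rw [← del_eq_proj]
    exact mem_image
  rw [h1, mem_union, mem_image, mem_image]
  constructor
  · rintro ⟨q, hq, rfl⟩
    obtain ⟨hq, hk⟩ := mem_side.1 hq
    rcases mem_biUnion_piece.1 hq with ⟨hqA, -⟩ | ⟨j, -, l, rfl⟩
    · exact Or.inl ⟨q, mem_side.2 ⟨hqA, hk⟩, rfl⟩
    · have hlk := hk _ (Sym2.mem_mk_left _ _)
      rw [vtx_apply] at hlk
      subst hlk
      exact Or.inr ⟨j, mem_univ _, by rw [Sym2.map_mk, proj_ins]⟩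
  · rintro (⟨q, hq, rfl⟩ | ⟨j, -, rfl⟩)
    · obtain ⟨hqA, hk⟩ := mem_side.1 hq
      refine ⟨q, mem_side.2 ⟨mem_biUnion_piece.2 (Or.inl ⟨hqA, fun h => ?_⟩), hk⟩, rfl⟩
      obtain ⟨v, hv, hvk⟩ := (mem_crossing.1 h).2 (k + 1)
      exact zmod_two_add_one_ne k (hvk.symm.trans (hk v hv))
    · refine ⟨s(vtx k j, ins i k (g j)), mem_side.2 ⟨mem_biUnion_piece.2
        (Or.inr ⟨j, crossing_mem j, k, rfl⟩), ?_⟩, by rw [Sym2.map_mk, proj_ins]⟩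
      intro v hv
      rcases Sym2.mem_iff.1 hv with rfl | rfl <;> simp

/-- The two kinds of pairs on the side `k` of a completion. -/
theorem mem_rho_biUnion_piece {g : {p // p ∈ crossing i A} → V m} {k : ZMod 2} {p : Pair m} :
    p ∈ (rho i k (A.biUnion (piece g)) : Finset (Pair m)) ↔
      (∃ q ∈ side i k A, Sym2.map (proj i) q = p) ∨ ∃ j, s(proj i (vtx k j), g j) = p := by
  rw [rho_biUnion_piece, mem_union, mem_image, mem_image]
  simp

theorem ins_mem_of_mem_map {k : ZMod 2} {q : Pair (m + 1)} (hq : q ∈ side i k A) {w : V m}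
    (hw : w ∈ Sym2.map (proj i) q) : ins i k w ∈ q := by
  obtain ⟨v, hv, rfl⟩ := Sym2.mem_map.1 hw
  rwa [ins_proj ((mem_side.1 hq).2 v hv)]

theorem isOdd_rho {g : {p // p ∈ crossing i A} → V m}
    (hg : (frame i hA hle hadd).Valid g univ) (k : ZMod 2) :
    IsOdd (rho i k (A.biUnion (piece g)) : Finset (Pair m)) := by
  have hside : ∀ q ∈ side i k A, ∀ j : {p // p ∈ crossing i A}, ∀ w,
      w ∈ Sym2.map (proj i) q → w ∉ s(proj i (vtx k j), g j) := by
    intro q hq j w hw hw'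
    have h1 := ins_mem_of_mem_map hq hw
    obtain ⟨hqA, hqk⟩ := mem_side.1 hq
    rcases Sym2.mem_iff.1 hw' with rfl | rfl
    · rw [ins_proj (vtx_apply k j)] at h1
      obtain rfl := hA.eq_of_mem hqA (crossing_mem j) h1 (vtx_mem k j)
      have := hqk _ (vtx_mem (k + 1) j)
      rw [vtx_apply] at this
      exact zmod_two_add_one_ne k this
    · exact hg.notMem j (mem_univ _) k (mem_base_frame.2 ⟨q, hqA, h1⟩)
  refine isOdd_of_eq_of_mem (fun p hp => ?_) fun p hp q hq w hwp hwq => ?_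
  · rcases mem_rho_biUnion_piece.1 hp with ⟨q, hq, rfl⟩ | ⟨j, rfl⟩
    · obtain ⟨hqA, hqk⟩ := mem_side.1 hq
      have hodd := hA.2 q hqA
      induction q using Sym2.ind with | _ a b
      rw [isOddPair_mk, par_eq_add_par_proj i, par_eq_add_par_proj i b,
        hqk a (Sym2.mem_mk_left _ _), hqk b (Sym2.mem_mk_right _ _)] at hodd
      rw [Sym2.map_mk, isOddPair_mk]
      exact fun h => hodd (by rw [h])
    · exact isOddPair_mk.2 (par_col_ne_par hg k j)
  · rcases mem_rho_biUnion_piece.1 hp with ⟨p', hp', rfl⟩ | ⟨j, rfl⟩ <;>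
      rcases mem_rho_biUnion_piece.1 hq with ⟨q', hq', rfl⟩ | ⟨j', rfl⟩
    · rw [hA.eq_of_mem (mem_side.1 hp').1 (mem_side.1 hq').1 (ins_mem_of_mem_map hp' hwp)
        (ins_mem_of_mem_map hq' hwq)]
    · exact absurd hwq (hside p' hp' j' w hwp)
    · exact absurd hwp (hside q' hq' j w hwq)
    · have hcol : ∀ j j' : {p // p ∈ crossing i A}, proj i (vtx k j) ≠ g j' := fun j j' h =>
        hg.notMem j' (mem_univ _) k (h ▸ (frame i hA hle hadd).col_mem_base k j)
      suffices j = j' by rw [this]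
      rcases Sym2.mem_iff.1 hwp with rfl | rfl <;> rcases Sym2.mem_iff.1 hwq with h | h
      · exact (frame i hA hle hadd).col_injective k h
      · exact absurd h (hcol _ _)
      · exact absurd h.symm (hcol _ _)
      · exact hg.injOn (mem_coe.2 (mem_univ _)) (mem_coe.2 (mem_univ _)) h

theorem card_rho_le (g : {p // p ∈ crossing i A} → V m) (k : ZMod 2) :
    #(rho i k (A.biUnion (piece g)) : Finset (Pair m)) ≤ sigma i k A + #(crossing i A) := by
  rw [rho_biUnion_piece]
  refine (card_union_le _ _).trans (add_le_add card_image_le (card_image_le.trans ?_))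
  simp

theorem mem_verts_rho {g : {p // p ∈ crossing i A} → V m} {k : ZMod 2} {w : V m} :
    w ∈ verts (rho i k (A.biUnion (piece g)) : Finset (Pair m)) ↔
      w ∈ (frame i hA hle hadd).base k ∪ univ.image g := by
  rw [mem_union, Frame.mem_base]
  constructor
  · rintro ⟨p, hp, hw⟩
    rcases mem_rho_biUnion_piece.1 hp with ⟨q, hq, rfl⟩ | ⟨j, rfl⟩
    · exact Or.inl (Or.inl (mem_sideVerts.2 ⟨q, hq, ins_mem_of_mem_map hq hw⟩))
    · rcases Sym2.mem_iff.1 hw with rfl | rfl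
      · exact Or.inl (Or.inr ⟨j, rfl⟩)
      · exact Or.inr (mem_image_of_mem _ (mem_univ _))
  · rintro ((h | ⟨j, rfl⟩) | h)
    · obtain ⟨q, hq, hw⟩ := mem_sideVerts.1 h
      exact ⟨_, mem_rho_biUnion_piece.2 (Or.inl ⟨q, hq, rfl⟩),
        Sym2.mem_map.2 ⟨_, hw, proj_ins i k w⟩⟩
    · exact ⟨_, mem_rho_biUnion_piece.2 (Or.inr ⟨j, rfl⟩), Sym2.mem_mk_left _ _⟩
    · obtain ⟨j, -, rfl⟩ := mem_image.1 h
      exact ⟨_, mem_rho_biUnion_piece.2 (Or.inr ⟨j, rfl⟩), Sym2.mem_mk_right _ _⟩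

/-- What remains to be checked for a side of a completion to be diminishable. -/
theorem isDiminishable_rho (hm : 5 ≤ m) {g : {p // p ∈ crossing i A} → V m}
    (hg : (frame i hA hle hadd).Valid g univ) (k : ZMod 2)
    (hfull : sigma i k A + #(crossing i A) = m →
      (2 ≤ #((frame i hA hle hadd).edges g univ k) ∨
        (1 ≤ #((frame i hA hle hadd).edges g univ k) ∧ ∃ p ∈ side i k A, IsEdgePair p)) ∧
      ∀ q, (frame i hA hle hadd).Safe g univ k q) :
    IsDiminishable (rho i k (A.biUnion (piece g)) : Finset (Pair m)) := by
  have hodd := isOdd_rho hg k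
  refine ⟨hodd, ?_⟩
  have hcard := card_rho_le g k
  have hk := hle k
  rcases hcard.trans hk |>.lt_or_eq with hlt | heq
  · exact Or.inl ⟨hlt, fun h => by omega⟩
  refine Or.inr ⟨heq, fun h => by omega, ?_, ?_⟩
  · have hedge : ∀ j ∈ (frame i hA hle hadd).edges g univ k,
        IsEdgePair s(proj i (vtx k j), g j) := fun j hj => isEdgePair_mk.2 (mem_filter.1 hj).2
    have hcol : ∀ j j' : {p // p ∈ crossing i A}, proj i (vtx k j) ≠ g j' := fun j j' h =>
        hg.notMem j' (mem_univ _) k (h ▸ (frame i hA hle hadd).col_mem_base k j)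
    rcases (hfull (by omega)).1 with h2 | ⟨h1, p, hp, hpe⟩
    · obtain ⟨j, hj, j', hj', hne⟩ := one_lt_card.1 h2
      refine ⟨_, mem_rho_biUnion_piece.2 (Or.inr ⟨j, rfl⟩), _,
        mem_rho_biUnion_piece.2 (Or.inr ⟨j', rfl⟩), fun h => hne ?_, hedge j hj, hedge j' hj'⟩
      rcases Sym2.mem_iff.1 (h ▸ Sym2.mem_mk_left _ _ :
        proj i (vtx k j) ∈ s(proj i (vtx k j'), g j')) with h | h
      · exact (frame i hA hle hadd).col_injective k h
      · exact absurd h (hcol _ _)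
    · obtain ⟨j, hj⟩ := card_pos.1 h1
      obtain ⟨hpA, hpk⟩ := mem_side.1 hp
      refine ⟨_, mem_rho_biUnion_piece.2 (Or.inl ⟨p, hp, rfl⟩), _,
        mem_rho_biUnion_piece.2 (Or.inr ⟨j, rfl⟩), fun h => ?_, ?_, hedge j hj⟩
      · have h1 := ins_mem_of_mem_map hp (h ▸ Sym2.mem_mk_right _ _ :
          g j ∈ Sym2.map (proj i) p)
        exact hg.notMem j (mem_univ _) k (mem_base_frame.2 ⟨p, hpA, h1⟩)
      · induction p using Sym2.ind with | _ a b
        rw [Sym2.map_mk, isEdgePair_mk]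
        exact proj_mem_nbr (by rw [hpk a (Sym2.mem_mk_left _ _), hpk b (Sym2.mem_mk_right _ _)])
          (isEdgePair_mk.1 hpe)
  · have hsafe := (hfull (by omega)).2
    rw [Set.eq_empty_iff_forall_notMem]
    rintro v ⟨hv, hvn⟩
    refine hvn ((mem_verts_rho (hA := hA) (hle := hle) (hadd := hadd)).2
      (hsafe _ v rfl fun w hw => ?_))
    exact mem_verts_rho.1 (hv w (adj_iff_mem_nbr.2 hw))

theorem exists_completion_of_solvable (hm : 5 ≤ m) {k : ZMod 2} {a b : ℕ}
    (h : (frame i hA hle hadd).Solvable k a b)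
    (ha : sigma i k A + #(crossing i A) = m →
      2 ≤ a ∨ (1 ≤ a ∧ ∃ p ∈ side i k A, IsEdgePair p))
    (hb : sigma i (k + 1) A + #(crossing i A) = m →
      2 ≤ b ∨ (1 ≤ b ∧ ∃ p ∈ side i (k + 1) A, IsEdgePair p)) :
    ∃ B : Finset (Pair (m + 1)), IsSimpleCompletion i A B ∧
      IsDiminishable (rho i 0 B : Finset (Pair m)) ∧
      IsDiminishable (rho i 1 B : Finset (Pair m)) := by
  obtain ⟨g, hg, hga, hgb, hsafe⟩ := h
  have key : ∀ l, IsDiminishable (rho i l (A.biUnion (piece g)) : Finset (Pair m)) := by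
    intro l
    refine isDiminishable_rho hm hg l fun hl => ⟨?_, hsafe l (by rwa [Fintype.card_coe])⟩
    rcases zmod_two_eq_or l k with rfl | rfl
    · exact (ha hl).imp (fun h => h.trans hga) fun h => ⟨h.1.trans hga, h.2⟩
    · exact (hb hl).imp (fun h => h.trans hgb) fun h => ⟨h.1.trans hgb, h.2⟩
  exact ⟨_, isSimpleCompletion_biUnion_piece hg, key 0, key 1⟩

end completion

end Projection

/-! ### Choice of the coordinate -/

/-- If all crossing pairs have the same class and the side `k` holds no other pair, then only
vertices of that parity are used on the side `k`. -/
theorem Frame.notMem_base_of_s_eq_zero {m : ℕ} {ι : Type*} [Fintype ι] {F : Frame m ι}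
    {k : ZMod 2} (hk : F.s k = 0) {v : V m} (hv : F.cnt (par v) = 0) : v ∉ F.base k := by
  intro h
  rcases mem_base.1 h with h | ⟨j, rfl⟩
  · have h1 := F.card_X k (par v)
    rw [hk, Nat.le_zero, card_eq_zero] at h1
    exact notMem_empty v (h1 ▸ mem_cl.2 ⟨h, rfl⟩)
  · have := F.cnt_pos j
    rw [F.par_col] at hv
    omega

section completion

variable {m : ℕ} {i : Fin (m + 1)} {A : Finset (Pair (m + 1))}

/-- If nothing is encompassed by `A`, a vertex encompassed on one side by `A` is not used on the
other side. -/
theorem notMem_base_of_enc_eq_empty {hA : IsOdd A}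
    {hle : ∀ k, sigma i k A + #(crossing i A) ≤ m} {hadd : #A ≤ m + 1} (henc : enc (verts A) = ∅)
    (k : ZMod 2) (v : V m) (hsub : nbr v ⊆ (frame i hA hle hadd).base k)
    (hv : v ∉ (frame i hA hle hadd).base k) : v ∉ (frame i hA hle hadd).base (k + 1) := by
  intro hv'
  rw [mem_base_frame] at hv hv'
  refine Set.eq_empty_iff_forall_notMem.1 henc (ins i k v) ⟨fun w hw => ?_, hv⟩
  obtain ⟨l, rfl⟩ := mem_nbr.1 (adj_iff_mem_nbr.1 hw)
  induction l using Fin.succAboveCases i with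
  | x => rwa [ins_add_e]
  | p l =>
    rw [ins_add_e_succAbove]
    exact mem_base_frame.1 (hsub (mem_nbr.2 ⟨l, rfl⟩))

/-- Two disjoint edge-pairs are separated by some coordinate. -/
theorem exists_separating {n : ℕ} {A : Finset (Pair n)} (hA : IsOdd A)
    (h : ∃ p ∈ A, ∃ q ∈ A, p ≠ q ∧ IsEdgePair p ∧ IsEdgePair q) : ∃ i, IsSeparating i A := by
  obtain ⟨p, hp, q, hq, hne, hpe, hqe⟩ := h
  induction p using Sym2.ind with | _ a b
  induction q using Sym2.ind with | _ c d
  obtain ⟨s, hs⟩ := mem_nbr.1 (isEdgePair_mk.1 hpe)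
  obtain ⟨t, ht⟩ := mem_nbr.1 (isEdgePair_mk.1 hqe)
  have hdisj : ∀ v, v ∈ s(a, b) → v ∉ s(c, d) := hA.1.1 _ hp _ hq hne
  by_contra hcon
  push Not at hcon
  have hac : ∀ i, i ≠ s → i ≠ t → a i = c i := by
    intro i his hit
    by_contra h
    have hb : b i = a i := by rw [hs, Pi.add_apply, e_of_ne his, add_zero]
    have hd : d i = c i := by rw [ht, Pi.add_apply, e_of_ne hit, add_zero]
    exact hcon i ⟨a, b, c, d, hp, hq, hpe, hqe, hb.symm, hb ▸ h, hd.symm⟩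
  -- The vertex that agrees with both pairs in all coordinates other than `s` and `t` belongs to
  -- both of them.
  have key : ∀ {n : ℕ} {v w : V n} {s : Fin n}, (∀ i, i ≠ s → v i = w i) →
      w = v ∨ w = v + e s := by
    intro n v w s h
    rcases zmod_two_eq_or (w s) (v s) with hws | hws
    · left
      funext i
      by_cases hi : i = s
      · rw [hi, hws]
      · exact (h i hi).symm
    · right
      funext i
      by_cases hi : i = s
      · rw [hi, hws, Pi.add_apply, e_self]
      · rw [Pi.add_apply, e_of_ne hi, add_zero, h i hi]
  let w : V n := Function.update a s (c s)
  have hw1 : w ∈ s(a, b) := by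
    rw [Sym2.mem_iff, hs]
    exact key fun i hi => (Function.update_of_ne hi _ _).symm
  have hw2 : w ∈ s(c, d) := by
    rw [Sym2.mem_iff, ht]
    refine key fun i hi => ?_
    by_cases his : i = s
    · subst his
      exact (Function.update_self i (c i) a).symm
    · exact ((Function.update_of_ne his _ _).trans (hac i his hi)).symm
  exact hdisj w hw1 hw2

/-- If every coordinate splits every pair, the pairs are antipodal, and they can only be odd in
odd dimension. -/
theorem odd_of_forall_side_eq_zero {n : ℕ} {A : Finset (Pair n)} (hA : IsOdd A)
    (hne : A.Nonempty) (h : ∀ i k, sigma i k A = 0) : Odd n := by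
  obtain ⟨p, hp⟩ := hne
  have hodd := hA.2 p hp
  induction p using Sym2.ind with | _ a b
  rw [isOddPair_mk] at hodd
  have hab : a + b = 1 := by
    funext i
    have : a i ≠ b i := by
      intro hi
      have h0 := card_eq_zero.1 (h i (a i))
      refine notMem_empty s(a, b) (h0 ▸ mem_side.2 ⟨hp, fun v hv => ?_⟩)
      rcases Sym2.mem_iff.1 hv with rfl | rfl
      exacts [rfl, hi.symm]
    rw [Pi.add_apply, zmod_two_ne_iff.1 this, add_right_comm, CharTwo.add_self_eq_zero, zero_add]
    rfl
  have h1 : par a + par b = (n : ZMod 2) := by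
    rw [← par_add, hab]
    simp [par]
  rw [zmod_two_ne_iff.1 hodd, add_right_comm, CharTwo.add_self_eq_zero, zero_add] at h1
  exact (ZMod.natCast_eq_one_iff_odd).1 h1.symm

/-- If every completion has fewer than `m` pairs on both sides, any completion will do. -/
theorem exists_completion_of_lt (hm : 5 ≤ m) (hA : IsOdd A) (hadd : #A ≤ m + 1)
    (hlt : ∀ k, sigma i k A + #(crossing i A) < m) :
    ∃ B : Finset (Pair (m + 1)), IsSimpleCompletion i A B ∧
      IsDiminishable (rho i 0 B : Finset (Pair m)) ∧
      IsDiminishable (rho i 1 B : Finset (Pair m)) := by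
  have hF := (frame i hA (fun k => (hlt k).le) hadd).exists_solution hm
    (by rw [Fintype.card_coe]; exact hlt)
  exact exists_completion_of_solvable hm hF (fun h => absurd h (hlt _).ne)
    (fun h => absurd h (hlt _).ne)

end completion

theorem exists_coordinate_of_card_lt {m : ℕ} (hm : 5 ≤ m) {A : Finset (Pair (m + 1))}
    (hA : IsOdd A) (hcard : #A < m) :
    ∃ i : Fin (m + 1), ∃ B : Finset (Pair (m + 1)), IsSimpleCompletion i A B ∧
      IsDiminishable (rho i 0 B : Finset (Pair m)) ∧
      IsDiminishable (rho i 1 B : Finset (Pair m)) := by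
  refine ⟨0, exists_completion_of_lt hm hA (by omega) fun k => ?_⟩
  have := card_side_add_card_crossing' 0 A k
  omega

/-- Diminishable pair-sets with one pair less than the dimension. A coordinate for which both sides
hold a pair is always good. If there is none, the pairs not crossing a coordinate lie on one side,
and that side of the completion is critical; if every coordinate crosses all pairs, both are. -/
theorem exists_coordinate_of_card_eq {m : ℕ} (hm : 5 ≤ m) {A : Finset (Pair (m + 1))}
    (hA : IsOdd A) (hcard : #A = m) :
    ∃ i : Fin (m + 1),
      (min (sigma i 0 A) (sigma i 1 A) = 0 ∧ #A - 2 ≤ max (sigma i 0 A) (sigma i 1 A)) ∨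
      ∃ B : Finset (Pair (m + 1)), IsSimpleCompletion i A B ∧
        IsDiminishable (rho i 0 B : Finset (Pair m)) ∧
        IsDiminishable (rho i 1 B : Finset (Pair m)) := by
  by_cases hmin : ∃ i : Fin (m + 1), 1 ≤ sigma i 0 A ∧ 1 ≤ sigma i 1 A
  · obtain ⟨i, h0, h1⟩ := hmin
    refine ⟨i, Or.inr (exists_completion_of_lt hm hA (by omega) fun k => ?_)⟩
    have h2 := card_side_add_card_crossing' i A k
    have h3 : 1 ≤ sigma i (k + 1) A := by
      rcases zmod_two_eq_or (k + 1) 0 with h | h <;> rw [h] <;> assumption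
    omega
  by_cases hmax : ∃ i : Fin (m + 1), #A - 2 ≤ max (sigma i 0 A) (sigma i 1 A)
  · obtain ⟨i, hi⟩ := hmax
    refine ⟨i, Or.inl ⟨?_, hi⟩⟩
    by_contra h
    exact hmin ⟨i, by omega, by omega⟩
  push Not at hmin hmax
  have hle : ∀ (i : Fin (m + 1)) k, sigma i k A + #(crossing i A) ≤ m := fun i k => by
    have := card_side_add_card_crossing' i A k
    omega
  have hcross : ∀ i : Fin (m + 1), 3 ≤ #(crossing i A) := fun i => by
    have h1 := hmin i
    have h2 := hmax i
    have h3 := card_side_add_card_crossing i A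
    omega
  by_cases hpos : ∃ (i : Fin (m + 1)) (k : ZMod 2), 1 ≤ sigma i k A
  · obtain ⟨i, k, hk⟩ := hpos
    have hk' : sigma i (k + 1) A = 0 := by
      have := hmin i
      rcases zmod_two_eq_or k 0 with rfl | rfl
      · rw [zero_add]
        omega
      · rw [zmod_two_add_one_add_one]
        rw [zero_add] at hk
        omega
    have hsum := card_side_add_card_crossing' i A k
    have hc := hcross i
    refine ⟨i, Or.inr ?_⟩
    have hsolv := Frame.solvable_of_one_side (F := frame i hA (hle i) (by omega)) (k := k) hm
      (by rw [Fintype.card_coe]; change sigma i k A + _ = m; omega) hk hk'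
      (by rw [Fintype.card_coe]; exact hc)
      fun v hv _ _ => Frame.notMem_base_of_s_eq_zero hk' hv
    exact exists_completion_of_solvable hm hsolv (fun _ => Or.inl le_rfl) (fun h => by omega)
  · push Not at hpos
    have hzero : ∀ (i : Fin (m + 1)) k, sigma i k A = 0 := fun i k => by
      have := hpos i k
      omega
    have hodd := odd_of_forall_side_eq_zero hA (card_pos.1 (by omega)) hzero
    have heven : Even m := by
      obtain ⟨t, ht⟩ := hodd
      exact ⟨t, by omega⟩
    have hsum := card_side_add_card_crossing 0 A
    have h0 := hzero 0 0
    have h1 := hzero 0 1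
    refine ⟨0, Or.inr ?_⟩
    have hsolv := Frame.solvable_of_all_crossing (F := frame 0 hA (hle 0) (by omega)) (k := 0) hm
      heven (hzero 0 0) (hzero 0 (0 + 1)) (by rw [Fintype.card_coe]; omega)
      fun k v hv _ _ => Frame.notMem_base_of_s_eq_zero (hzero 0 (k + 1)) hv
    exact exists_completion_of_solvable hm hsolv (fun _ => Or.inl le_rfl)
      (fun _ => Or.inl le_rfl)

/-- Diminishable pair-sets with as many pairs as the dimension. The coordinate is one that separates
two edge-pairs, so each side inherits an edge-pair of `A`, and a critical side needs only one new
one. -/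
theorem exists_coordinate_of_card_eq_succ {m : ℕ} (hm : 5 ≤ m) {A : Finset (Pair (m + 1))}
    (hA : IsOdd A) (hcard : #A = m + 1)
    (hedge : ∃ p ∈ A, ∃ q ∈ A, p ≠ q ∧ IsEdgePair p ∧ IsEdgePair q)
    (henc : enc (verts A) = ∅) :
    ∃ i : Fin (m + 1),
      (IsSeparating i A ∧ min (sigma i 0 A) (sigma i 1 A) = 1 ∧
        m + 1 - 3 ≤ max (sigma i 0 A) (sigma i 1 A)) ∨
      ∃ B : Finset (Pair (m + 1)), IsSimpleCompletion i A B ∧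
        IsDiminishable (rho i 0 B : Finset (Pair m)) ∧
        IsDiminishable (rho i 1 B : Finset (Pair m)) := by
  obtain ⟨i, hi⟩ := exists_separating hA hedge
  refine ⟨i, ?_⟩
  have hside : ∀ k, ∃ p ∈ side i k A, IsEdgePair p := by
    obtain ⟨a, b, c, d, hp, hq, hpe, hqe, hab, hbc, hcd⟩ := hi
    intro k
    rcases zmod_two_eq_or k (b i) with rfl | hk
    · refine ⟨_, mem_side.2 ⟨hp, fun v hv => ?_⟩, hpe⟩
      rcases Sym2.mem_iff.1 hv with rfl | rfl
      exacts [hab, rfl]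
    · rw [← zmod_two_ne_iff.1 hbc.symm] at hk
      refine ⟨_, mem_side.2 ⟨hq, fun v hv => ?_⟩, hqe⟩
      rcases Sym2.mem_iff.1 hv with rfl | rfl
      exacts [hk.symm, (hk.trans hcd).symm]
  have hpos : ∀ k, 1 ≤ sigma i k A := fun k => by
    obtain ⟨p, hp, -⟩ := hside k
    exact card_pos.2 ⟨p, hp⟩
  have hsum := card_side_add_card_crossing' i A
  have hle : ∀ k, sigma i k A + #(crossing i A) ≤ m := fun k => by
    have h1 := hsum k
    have h2 := hpos (k + 1)
    omega
  by_cases htwo : ∀ k, 2 ≤ sigma i k A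
  · refine Or.inr (exists_completion_of_lt hm hA hcard.le fun k => ?_)
    have h1 := hsum k
    have h2 := htwo (k + 1)
    omega
  push Not at htwo
  obtain ⟨l, hl⟩ := htwo
  obtain ⟨k, rfl⟩ : ∃ k, l = k + 1 := ⟨l + 1, (zmod_two_add_one_add_one l).symm⟩
  have hk1 : sigma i (k + 1) A = 1 := by
    have := hpos (k + 1)
    omega
  have hminmax : min (sigma i 0 A) (sigma i 1 A) = 1 ∧
      max (sigma i 0 A) (sigma i 1 A) = sigma i k A := by
    have hk := hpos k
    rcases zmod_two_eq_or k 0 with rfl | rfl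
    · rw [zero_add] at hk1
      omega
    · rw [zmod_two_add_one_add_one] at hk1
      rw [zero_add] at hk ⊢
      omega
  by_cases hmax : m + 1 - 3 ≤ sigma i k A
  · exact Or.inl ⟨hi, hminmax.1, hminmax.2.symm ▸ hmax⟩
  right
  have hsk := hsum k
  have hH : ∀ k v, (frame i hA hle hcard.le).cnt (par v) = 0 →
      nbr v ⊆ (frame i hA hle hcard.le).base k → v ∉ (frame i hA hle hcard.le).base k →
      v ∉ (frame i hA hle hcard.le).base (k + 1) :=
    fun k v _ h1 h2 => notMem_base_of_enc_eq_empty henc k v h1 h2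
  rcases (hpos k).eq_or_lt with hk | hk
  · have hsolv := Frame.solvable_of_two_lone_pairs hm (k := k) hk.symm hk1
      (by rw [Fintype.card_coe]; omega) hH
    exact exists_completion_of_solvable hm hsolv (fun _ => Or.inr ⟨le_rfl, hside k⟩)
      (fun _ => Or.inr ⟨le_rfl, hside (k + 1)⟩)
  · have hsolv := Frame.solvable_of_lone_pair (F := frame i hA hle hcard.le) hm (k := k)
      (by rw [Fintype.card_coe]; change sigma i k A + _ = m; omega) hk hk1
      (by rw [Fintype.card_coe]; omega) (hH k)
    exact exists_completion_of_solvable hm hsolv (fun _ => Or.inr ⟨le_rfl, hside k⟩)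
      (fun h => by omega)

end HypercubePairs

theorem mainTheorem4 (n : ℕ) (hn : 6 ≤ n) (A : Finset (Pair n)) (hA : IsDiminishable A) :
    ∃ i : Fin n,
      (A.card = n - 1 ∧ min (sigma i 0 A) (sigma i 1 A) = 0 ∧
        A.card - 2 ≤ max (sigma i 0 A) (sigma i 1 A)) ∨
      (A.card = n ∧ IsSeparating i A ∧ min (sigma i 0 A) (sigma i 1 A) = 1 ∧
        n - 3 ≤ max (sigma i 0 A) (sigma i 1 A)) ∨
      (A.card = n ∧ IsBad i A) ∨
      (∃ B : Finset (Pair n), IsSimpleCompletion i A B ∧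
        IsDiminishable (rho i 0 B) ∧ IsDiminishable (rho i 1 B)) := by
  obtain ⟨m, rfl⟩ : ∃ m, n = m + 1 := ⟨n - 1, by omega⟩
  have hm : 5 ≤ m := by omega
  obtain ⟨hodd, ⟨hlt, -⟩ | ⟨heq, -, hedge, henc⟩⟩ := hA
  · rcases Nat.lt_succ_iff_lt_or_eq.1 hlt with hlt | heq
    · obtain ⟨i, hi⟩ := exists_coordinate_of_card_lt hm hodd hlt
      exact ⟨i, Or.inr (Or.inr (Or.inr hi))⟩
    · obtain ⟨i, hi | hi⟩ := exists_coordinate_of_card_eq hm hodd heq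
      · exact ⟨i, Or.inl ⟨heq, hi⟩⟩
      · exact ⟨i, Or.inr (Or.inr (Or.inr hi))⟩
  · obtain ⟨i, hi | hi⟩ := exists_coordinate_of_card_eq_succ hm hodd heq hedge henc
    · exact ⟨i, Or.inr (Or.inl ⟨heq, hi⟩)⟩
    · exact ⟨i, Or.inr (Or.inr (Or.inr hi))⟩
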